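/- Let $\mathbb{F}_q$ be a finite field with algebraic closure $\overline{\mathbb{F}}_q$, let $n,R,e\ge 0$ and $d_1,\dots,d_R\ge 1$ be integers, and let $F_1,\dots,F_R\in\mathbb{F}_q[x_1,\dots,x_n]$ be forms of degrees $d_1,\dots,d_R$ (a form may be zero), with common zero locus $X=V(F_1,\dots,F_R)\subset\mathbb{P}^{n-1}$. Identify a non-zero tuple $\boldsymbol{x}(t)=(x_1(t),\dots,x_n(t))$ of polynomials of degree at most $e$ over $\overline{\mathbb{F}}_q$, up to scaling, with the point of $\mathbb{P}^{n(e+1)-1}$ given by its coefficients. Let $\operatorname{Mor}_e(\mathbb{P}^1,X)\subset\mathbb{P}^{n(e+1)-1}$ be the locally closed set over $\overline{\mathbb{F}}_q$ of those $[\boldsymbol{x}(t)]$ for which $\max_i\deg x_i=e$, $\gcd(x_1,\dots,x_n)=1$ in $\overline{\mathbb{F}}_q[t]$, and $F_i(\boldsymbol{x}(t))=0$ identically in $t$ for $i=1,\dots,R$. Let $Z\subset\operatorname{Mor}_e(\mathbb{P}^1,X)$ be a non-empty union of irreducible components (over $\overline{\mathbb{F}}_q$) of $\operatorname{Mor}_e(\mathbb{P}^1,X)$.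 Let $\dim(Z)$ be the dimension of the Zariski closure of $Z$ in $\mathbb{P}^{n(e+1)-1}$, i.e. the maximal dimension of its irreducible components, and let $Z(\mathbb{F}_q)$ be the set of points of $Z$ that have homogeneous coordinates in $\mathbb{F}_q$. Then, with $$C=\prod_{i=1}^R d_i^{d_i},$$ we have $$\#Z(\mathbb{F}_q)\le 2\,d_1\cdots d_R\,C^e\,q^{\dim(Z)}.$$ -/

import Mathlib

namespace RatCurves

/-- The set of points of the projective space with homogeneous coordinates indexed by `ι`
over the field `L`, that is, the lines through the origin of `ι → L`. -/
def ProjSpace (L : Type*) [Field L] (ι : Type*) : Type _ :=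
  Projectivization L (ι → L)

namespace ProjSpace

variable {L : Type*} [Field L] {ι : Type*}

/-- The point `[v]` of projective space with homogeneous coordinates `v ≠ 0`. -/
def mk (v : ι → L) (hv : v ≠ 0) : ProjSpace L ι :=
  Projectivization.mk L v hv

/-- A vector of homogeneous coordinates of a point. -/
noncomputable def coords (p : ProjSpace L ι) : ι → L :=
  Projectivization.rep p

/-- Vanishing of a homogeneous polynomial at a point does not depend on the choice of
homogeneous coordinates. -/
theorem eval_coords_mk_eq_zero_iff {f : MvPolynomial ι L} {m : ℕ} (hf : f.IsHomogeneous m)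
    (v : ι → L) (hv : v ≠ 0) :
    MvPolynomial.eval (mk v hv).coords f = 0 ↔ MvPolynomial.eval v f = 0 := by
  obtain ⟨a, ha⟩ := Projectivization.exists_smul_eq_mk_rep L v hv
  have h1 : (mk v hv).coords = fun i => (a : L) * v i := by
    rw [coords, mk, ← ha]
    rfl
  have h2 : MvPolynomial.eval (fun i => (a : L) * v i) f
      = (a : L) ^ m * MvPolynomial.eval v f := by
    rw [MvPolynomial.eval_eq, MvPolynomial.eval_eq, Finset.mul_sum]
    refine Finset.sum_congr rfl fun s hs => ?_
    have hdeg : ∑ i ∈ s.support, s i = m := by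
      have := hf (MvPolynomial.mem_support_iff.mp hs)
      rwa [Finsupp.weight_apply, Finsupp.sum, Finset.sum_congr rfl
        (fun i _ => by simp : ∀ i ∈ s.support, s i • (1 : ι → ℕ) i = s i)] at this
    simp only [mul_pow, Finset.prod_mul_distrib, Finset.prod_pow_eq_pow_sum, hdeg]
    ring
  rw [h1, h2]
  simp

/-- The common zero set in projective space of a set of homogeneous polynomials. -/
def zeroSet (S : Set (MvPolynomial ι L)) : Set (ProjSpace L ι) :=
  {p | ∀ f ∈ S, MvPolynomial.eval p.coords f = 0}

/-- Zariski-closed subsets: common zero sets of (possibly infinite) sets of homogeneous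
polynomials, of possibly different degrees. -/
def IsZariskiClosed (Y : Set (ProjSpace L ι)) : Prop :=
  ∃ S : Set (MvPolynomial ι L), (∀ f ∈ S, ∃ m : ℕ, f.IsHomogeneous m) ∧ Y = zeroSet S

/-- The Zariski topology on projective space. -/
instance zariskiTopology : TopologicalSpace (ProjSpace L ι) :=
  TopologicalSpace.ofClosed {Y | IsZariskiClosed Y}
    (by
      refine ⟨{1}, ?_, ?_⟩
      · rintro f rfl
        exact ⟨0, MvPolynomial.isHomogeneous_one ι L⟩
      · ext p
        simp [zeroSet])
    (by
      intro A hA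
      refine ⟨{f | (∃ m : ℕ, f.IsHomogeneous m) ∧
        ∃ Y ∈ A, ∀ p ∈ Y, MvPolynomial.eval p.coords f = 0}, fun f hf => hf.1, ?_⟩
      ext p
      constructor
      · rintro hp f ⟨-, Y, hY, hf⟩
        exact hf p (hp Y hY)
      · intro hp Y hY
        obtain ⟨S, hS, rfl⟩ := hA hY
        intro f hf
        exact hp f ⟨hS f hf, _, hY, fun r hr => hr f hf⟩)
    (by
      rintro _ ⟨S, hS, rfl⟩ _ ⟨T, hT, rfl⟩
      refine ⟨{h | ∃ f ∈ S, ∃ g ∈ T, h = f * g}, ?_, ?_⟩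
      · rintro _ ⟨f, hf, g, hg, rfl⟩
        obtain ⟨a, ha⟩ := hS f hf
        obtain ⟨b, hb⟩ := hT g hg
        exact ⟨a + b, ha.mul hb⟩
      · ext p
        constructor
        · rintro (hp | hp) _ ⟨f, hf, g, hg, rfl⟩
          · simp [hp f hf]
          · simp [hp g hg]
        · intro hp
          by_contra hcon
          simp only [Set.mem_union, not_or, zeroSet, Set.mem_ofPred_eq, not_forall] at hcon
          obtain ⟨⟨f, hf, hf0⟩, g, hg, hg0⟩ := hcon
          have h0 := hp _ ⟨f, hf, g, hg, rfl⟩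
          rw [map_mul] at h0
          exact (mul_ne_zero hf0 hg0) h0)

theorem isClosed_iff_isZariskiClosed (Y : Set (ProjSpace L ι)) :
    IsClosed Y ↔ IsZariskiClosed Y := by
  rw [← isOpen_compl_iff]
  change IsZariskiClosed Yᶜᶜ ↔ IsZariskiClosed Y
  rw [compl_compl]

/-- The dimension of a (locally closed) subset of projective space: the Krull dimension of its
Zariski closure, with value `⊥` for the empty set. -/
noncomputable def dim (Z : Set (ProjSpace L ι)) : WithBot ℕ∞ :=
  topologicalKrullDim (closure Z)

/-- `Z` is the union of some of the irreducible components of the subset `M` of projective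
space, where `M` carries the induced Zariski topology. -/
def IsUnionOfComponents (M Z : Set (ProjSpace L ι)) : Prop :=
  ∃ T : Set (Set M), T ⊆ irreducibleComponents M ∧ Z = Subtype.val '' ⋃₀ T

/-- The `K`-rational points of a subset of projective space over an extension `L` of `K`: the
points that have homogeneous coordinates in `K`. -/
def rationalPoints (K : Type*) [Field K] [Algebra K L] (Z : Set (ProjSpace L ι)) :
    Set (ProjSpace L ι) :=
  {p ∈ Z | ∃ (v : ι → K) (hv : (fun i => algebraMap K L (v i)) ≠ 0), p = mk _ hv}

end ProjSpace

section Mor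

variable {K : Type*} [Field K] {n R : ℕ}

/-- The tuple `(x₁(t), …, xₙ(t))` of polynomials of degree at most `e` whose coefficients are
the entries of `a`: the coefficient of `t ^ j` in `xᵢ` is `a (i, j)`. -/
noncomputable def polyTuple {L : Type*} [Field L] {e : ℕ} (a : Fin n × Fin (e + 1) → L) :
    Fin n → Polynomial L :=
  fun i => ∑ j : Fin (e + 1), Polynomial.monomial (j : ℕ) (a (i, j))

/-- The subvariety `Y_e` of `ℙ^{n(e+1)-1}` over the algebraic closure of `K`: the classes of
tuples `x(t)` with `F₁(x(t)) = ⋯ = F_R(x(t)) = 0` identically in `t`. -/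
def equationLocus (F : Fin R → MvPolynomial (Fin n) K) (e : ℕ) :
    Set (ProjSpace (AlgebraicClosure K) (Fin n × Fin (e + 1))) :=
  {p | ∀ i, MvPolynomial.aeval (polyTuple p.coords) (F i) = 0}

/-- The subset `U_e` of `ℙ^{n(e+1)-1}` over the algebraic closure of `K`: the classes of tuples
`x(t)` of coprime polynomials, the maximum of whose degrees is exactly `e`. -/
def coprimeLocus (K : Type*) [Field K] (n e : ℕ) :
    Set (ProjSpace (AlgebraicClosure K) (Fin n × Fin (e + 1))) :=
  {p | (∃ i, (polyTuple p.coords i).degree = e) ∧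
    ∀ g : Polynomial (AlgebraicClosure K), (∀ i, g ∣ polyTuple p.coords i) → IsUnit g}

/-- The space `Mor_e(ℙ¹, X)` of morphisms of degree `e` from `ℙ¹` to the projective variety
`X = V(F₁, …, F_R) ⊆ ℙ^{n-1}`, as a locally closed subset of `ℙ^{n(e+1)-1}` over the algebraic
closure of `K`: the class of `x(t)` corresponds to the morphism `t ↦ [x₁(t) : ⋯ : xₙ(t)]`. -/
def morSpace (F : Fin R → MvPolynomial (Fin n) K) (e : ℕ) :
    Set (ProjSpace (AlgebraicClosure K) (Fin n × Fin (e + 1))) :=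
  coprimeLocus K n e ∩ equationLocus F e

end Mor

end RatCurves

/-! The coefficients of the powers of t in F_i(x(t)) are d_i e + 1 forms of degree d_i in the n(e+1)
coefficients of x. Let I be the ideal they generate over all i; the product of their degrees is ∏
d_i^(d_i e + 1) = d_1⋯d_R C^e, called D below. Being coprime of exact degree e is an open condition
(`isOpen_coprimeLocus`), so the vanishing ideal of each component of Mor_e is a minimal prime of I
(`idealOf_mem_minimalPrimes`).

Two classical facts then give the bound: an affine variety of dimension r and degree δ has at most δ
q^r points over F_q, and the degrees of the components of an intersection of hypersurfaces, whatever
their dimensions, add up to at most the product of the degrees of the equations. Degrees are never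
defined: `HilbertLowerBound P r w` says that the affine Hilbert function of P grows at least like w
k^r / r!, which replaces "degree at least w". `hilbertLowerBound_ncard_rationalZeros` provides w =
#P(F_q) / q^r, and `sum_le_prod_of_hilbertLowerBound` bounds the sum of these weights by D. Both
rest on cutting with one hypersurface (`HilbertLowerBound.of_minimalPrimes`) and on the dimension
dropping by exactly one (`quotDim_add_one`).

The affine cones over the components of Z have dimension at most dim Z + 1 (by `le_height_zeros`),
so together they contain at most D q^(dim Z + 1) rational vectors. Each rational point accounts for
q - 1 of them, and q ≤ 2(q - 1) yields the factor 2. -/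

namespace RatCurves

open Cardinal Algebra

/-! ### Transcendence degree of a polynomial ring modulo a prime element -/

section TranscendenceDegree

universe u

theorem trdeg_eq_of_isAlgebraic (L : Type u) {A B : Type u} [Field L] [CommRing A] [CommRing B]
    [IsDomain B] [Algebra L A] [Algebra L B] [Algebra A B] [IsScalarTower L A B]
    (hinj : Function.Injective (algebraMap A B)) [Algebra.IsAlgebraic A B] :
    Algebra.trdeg L A = Algebra.trdeg L B := by
  have : FaithfulSMul A B := (faithfulSMul_iff_algebraMap_injective A B).mpr hinj
  have : IsDomain A := hinj.isDomain
  rw [← trdeg_add_eq L A (A := B), trdeg_eq_zero (R := A) (A := B), add_zero]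

theorem exists_pos_degreeOf {σ L : Type*} [Field L] {h : MvPolynomial σ L} (h0 : h ≠ 0)
    (hu : ¬ IsUnit h) : ∃ j, 0 < h.degreeOf j := by
  classical
  by_contra! hcon
  have hC : h = MvPolynomial.C (h.coeff 0) := by
    ext m
    rw [MvPolynomial.coeff_C]
    split_ifs with hm
    · rw [hm]
    · by_contra hc
      obtain ⟨j, hj⟩ := Finsupp.ne_iff.mp (Ne.symm hm)
      have := MvPolynomial.monomial_le_degreeOf j (MvPolynomial.mem_support_iff.mpr hc)
      have := hcon j
      simp at hj
      omega
  apply hu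
  rw [hC]
  refine IsUnit.map _ (IsUnit.mk0 _ fun h1 => h0 ?_)
  rw [hC, h1, map_zero]

/-- Pick a variable X_j occurring in h. The other variables stay independent modulo h, because a
nonzero multiple of h has positive degree in X_j; all s variables together do not, because h itself
is a relation. -/
theorem trdeg_quotient_span_prime {L : Type u} [Field L] {s : ℕ} {h : MvPolynomial (Fin s) L}
    (hp : Prime h) :
    Algebra.trdeg L (MvPolynomial (Fin s) L ⧸ Ideal.span {h}) + 1 = s := by
  obtain ⟨j, hj⟩ := exists_pos_degreeOf hp.ne_zero hp.not_isUnit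
  have hprime : (Ideal.span {h}).IsPrime := (Ideal.span_singleton_prime hp.ne_zero).mpr hp
  set π : MvPolynomial (Fin s) L →ₐ[L] MvPolynomial (Fin s) L ⧸ Ideal.span {h} :=
    Ideal.Quotient.mkₐ L _
  have hle : Algebra.trdeg L (MvPolynomial (Fin s) L ⧸ Ideal.span {h}) ≤ s := by
    have := trdeg_le_of_surjective π (Ideal.Quotient.mkₐ_surjective L _)
    simpa using this
  have hind : AlgebraicIndependent L (fun i : {i : Fin s // i ≠ j} => π (MvPolynomial.X i.1)) := by
    rw [algebraicIndependent_iff]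
    intro p hp0
    have h1 : MvPolynomial.aeval (fun i : {i : Fin s // i ≠ j} => π (MvPolynomial.X i.1)) p
        = π (MvPolynomial.rename Subtype.val p) := by
      have : MvPolynomial.aeval (fun i : {i : Fin s // i ≠ j} => π (MvPolynomial.X i.1))
        = π.comp (MvPolynomial.rename Subtype.val) := by
        apply MvPolynomial.algHom_ext
        intro i
        simp
      rw [this]; rfl
    rw [h1] at hp0
    have h2 : MvPolynomial.rename Subtype.val p ∈ Ideal.span {h} := by
      rwa [← Ideal.Quotient.eq_zero_iff_mem]
    obtain ⟨c, hc⟩ := Ideal.mem_span_singleton.mp h2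
    by_contra hpne
    have hr : MvPolynomial.rename (Subtype.val : {i : Fin s // i ≠ j} → Fin s) p ≠ 0 := by
      intro h0
      exact hpne (MvPolynomial.rename_injective _ Subtype.val_injective (by simpa using h0))
    have hcne : c ≠ 0 := by
      rintro rfl
      simp at hc
      exact hpne hc
    have hd : (MvPolynomial.rename (Subtype.val : {i : Fin s // i ≠ j} → Fin s) p).degreeOf j
        = 0 := by
      rw [← Nat.le_zero, MvPolynomial.degreeOf_le_iff]
      intro m hm
      rw [Nat.le_zero]
      rw [MvPolynomial.support_rename_of_injective Subtype.val_injective] at hm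
      obtain ⟨m', -, rfl⟩ := Finset.mem_image.mp hm
      exact Finsupp.mapDomain_of_notMem_range _ _ (by simp)
    rw [hc, MvPolynomial.degreeOf_mul_eq hp.ne_zero hcne] at hd
    omega
  have hge : ((s - 1 : ℕ) : Cardinal) ≤ Algebra.trdeg L (MvPolynomial (Fin s) L ⧸ Ideal.span {h}) := by
    have := hind.lift_cardinalMk_le_trdeg
    simpa [Fintype.card_subtype_compl] using this
  have hspos : 0 < s := j.pos
  have hne : Algebra.trdeg L (MvPolynomial (Fin s) L ⧸ Ideal.span {h}) ≠ s := by
    intro heq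
    have hadj : Algebra.adjoin L (Set.range fun i : Fin s => π (MvPolynomial.X i)) = ⊤ := by
      have : (Set.range fun i : Fin s => π (MvPolynomial.X i))
          = π '' Set.range (MvPolynomial.X : Fin s → MvPolynomial (Fin s) L) := by
        rw [← Set.range_comp]; rfl
      rw [this, ← AlgHom.map_adjoin, MvPolynomial.adjoin_range_X, Algebra.map_top]
      exact (AlgHom.range_eq_top _).mpr (Ideal.Quotient.mkₐ_surjective L _)
    have : IsDomain (MvPolynomial (Fin s) L ⧸ Ideal.span {h}) := Ideal.Quotient.isDomain _
    have : Algebra.IsAlgebraic (Algebra.adjoin L (Set.range fun i : Fin s => π (MvPolynomial.X i)))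
        (MvPolynomial (Fin s) L ⧸ Ideal.span {h}) := by
      constructor
      intro x
      exact isAlgebraic_algebraMap
        (⟨x, hadj ▸ Algebra.mem_top⟩ : Algebra.adjoin L (Set.range fun i : Fin s =>
          π (MvPolynomial.X i)))
    have hb := Algebra.IsAlgebraic.isTranscendenceBasis_of_lift_le_trdeg_of_finite L
      (fun i : Fin s => π (MvPolynomial.X i)) (by rw [heq]; simp)
    have hi := hb.1
    rw [algebraicIndependent_iff] at hi
    apply hp.ne_zero
    apply hi
    have : MvPolynomial.aeval (fun i : Fin s => π (MvPolynomial.X i)) = π := by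
      ext i; simp
    rw [this]
    exact Ideal.Quotient.eq_zero_iff_mem.mpr (Ideal.mem_span_singleton_self h)
  have hfin : Algebra.trdeg L (MvPolynomial (Fin s) L ⧸ Ideal.span {h}) < ℵ₀ :=
    hle.trans_lt (natCast_lt_aleph0)
  obtain ⟨t, ht⟩ := lt_aleph0.mp hfin
  rw [ht] at hle hge hne ⊢
  norm_cast at hle hge hne ⊢
  omega

end TranscendenceDegree

/-- Norm argument: let n0 be the norm of f from F(f) to F. It lies in A, which is integrally closed,
and f divides it, since up to sign it is the constant term of the minimal polynomial of f. If a ∈ Q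
∩ A, then a^k = f b with b integral, and taking norms shows that n0 divides a power of a. So Q ∩ A
is the radical of (n0), and a prime ideal of this kind in a factorial ring is principal. The norm is
taken from F(f) because E need not be finite over F. -/
theorem exists_prime_comap_eq_span_of_isFractionRing {A B : Type*} (F E : Type*) [CommRing A]
    [IsDomain A] [UniqueFactorizationMonoid A] [CommRing B] [IsDomain B] [Algebra A B]
    [Algebra.IsIntegral A B] [Field F] [Field E] [Algebra A F] [IsFractionRing A F] [Algebra B E]
    [IsFractionRing B E] [Algebra A E] [Algebra F E] [IsScalarTower A B E] [IsScalarTower A F E]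
    {f : B} (hf : f ≠ 0) (Q : Ideal B) [Q.IsPrime] (hfQ : f ∈ Q) (hQ : ∀ x ∈ Q, ∃ k, f ∣ x ^ k) :
    ∃ π : A, Prime π ∧ Q.comap (algebraMap A B) = Ideal.span {π} := by
  classical
  set f' : E := algebraMap B E f
  have hf' : f' ≠ 0 := by simpa [f'] using hf
  have hfint : IsIntegral A f := Algebra.IsIntegral.isIntegral f
  have hf'int : IsIntegral A f' := hfint.algebraMap
  have hf'F : IsIntegral F f' := hf'int.tower_top
  set G := IntermediateField.adjoin F {f'}
  have : FiniteDimensional F G := IntermediateField.adjoin.finiteDimensional hf'F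
  have : Module.Free F G := Module.Free.of_divisionRing F G
  set γ : G := IntermediateField.AdjoinSimple.gen F f'
  have hγ : algebraMap G E γ = f' := IntermediateField.AdjoinSimple.algebraMap_gen F f'
  have key : ∀ x : G, IsIntegral A (algebraMap G E x) → ∃ a : A, algebraMap A F a
      = Algebra.norm F x := by
    intro x hx
    have hx' : IsIntegral A x := by
      have hinj : Function.Injective (G.val.restrictScalars A) :=
        (algebraMap G E).injective
      exact (isIntegral_algHom_iff (G.val.restrictScalars A) hinj).mp hx
    exact IsIntegrallyClosed.isIntegral_iff.mp (Algebra.isIntegral_norm F hx')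
  obtain ⟨n0, hn0⟩ := key γ (by rw [hγ]; exact hf'int)
  set pb := IntermediateField.adjoin.powerBasis hf'F
  have hn0' : algebraMap A F n0 = (-1) ^ pb.dim * (minpoly F f').coeff 0 := by
    have h1 := Algebra.PowerBasis.norm_gen_eq_coeff_zero_minpoly pb
    have h2 : pb.gen = γ := IntermediateField.adjoin.powerBasis_gen hf'F
    rw [h2] at h1
    rw [hn0, h1]
    congr 2
    exact IntermediateField.minpoly_gen F f'
  have hmin : minpoly F f' = (minpoly A f').map (algebraMap A F) :=
    minpoly.isIntegrallyClosed_eq_field_fractions' F hf'int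
  have hn0'' : n0 = (-1) ^ pb.dim * (minpoly A f').coeff 0 := by
    apply IsFractionRing.injective A F
    rw [hn0', hmin, Polynomial.coeff_map]
    simp
  have hmin2 : minpoly A f' = minpoly A f :=
    minpoly.algebraMap_eq (IsFractionRing.injective B E) f
  have hdvd : f ∣ algebraMap A B n0 := by
    rw [hn0'', hmin2, map_mul]
    refine Dvd.dvd.mul_left ?_ _
    have h1 := minpoly.aeval A f
    rw [Polynomial.aeval_eq_sum_range, Finset.sum_range_succ'] at h1
    simp only [pow_zero, Algebra.smul_def, mul_one] at h1
    rw [add_comm, add_eq_zero_iff_eq_neg] at h1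
    rw [h1, dvd_neg]
    exact Finset.dvd_sum fun i _ => (dvd_pow_self f (by omega)).mul_left _
  have hn0ne : n0 ≠ 0 := by
    intro h0
    have h1 : Algebra.norm F γ = 0 := by rw [← hn0, h0, map_zero]
    rw [Algebra.norm_eq_zero_iff] at h1
    apply hf'
    rw [← hγ, h1, map_zero]
  have hpow : ∀ a : A, algebraMap A B a ∈ Q → ∃ k, n0 ∣ a ^ k := by
    intro a ha
    obtain ⟨k, b, hb⟩ := hQ _ ha
    have hbE : algebraMap A E a ^ k = f' * algebraMap B E b := by
      rw [IsScalarTower.algebraMap_apply A B E, ← map_pow, hb, map_mul]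
    -- The cofactor b equals a^k / f, hence lies in F(f), where its norm makes sense.
    set β : G := algebraMap F G (algebraMap A F a) ^ k / γ
    have hγ0 : γ ≠ 0 := by
      intro h0
      apply hf'
      rw [← hγ, h0, map_zero]
    have hβ : algebraMap G E β = algebraMap B E b := by
      simp only [β, map_div₀, map_pow, hγ]
      rw [div_eq_iff hf', mul_comm, ← hbE, ← IsScalarTower.algebraMap_apply F G E,
        ← IsScalarTower.algebraMap_apply A F E]
    obtain ⟨c, hc⟩ := key β (by
      rw [hβ]
      exact (Algebra.IsIntegral.isIntegral (R := A) b).algebraMap)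
    refine ⟨k * Module.finrank F G, c, ?_⟩
    apply IsFractionRing.injective A F
    rw [map_mul, hn0, hc, ← map_mul]
    have h3 : γ * β = algebraMap F G (algebraMap A F a ^ k) := by
      simp only [β, map_pow]
      field_simp
    rw [h3, Algebra.norm_algebraMap, map_pow, pow_mul]
  have hn0Q : n0 ∈ Q.comap (algebraMap A B) := Q.mem_of_dvd hdvd hfQ
  have hprime : (Q.comap (algebraMap A B)).IsPrime := Ideal.comap_isPrime _ _
  obtain ⟨π, hπQ, hπ⟩ := hprime.exists_mem_prime_of_ne_bot (by
    intro h0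
    rw [h0] at hn0Q
    exact hn0ne hn0Q)
  refine ⟨π, hπ, le_antisymm ?_ ((Ideal.span_singleton_le_iff_mem _).mpr hπQ)⟩
  intro a ha
  rw [Ideal.mem_span_singleton]
  -- Since n0 divides a power of π, it is associated to some π^j, and j ≠ 0 because n0 is not a
  -- unit. Hence π divides n0, which divides a power of any a in the contraction.
  obtain ⟨k, hk⟩ := hpow π hπQ
  obtain ⟨k', hk'⟩ := hpow a ha
  obtain ⟨j, -, hj⟩ := (dvd_prime_pow hπ k).mp hk
  have hjpos : j ≠ 0 := by
    rintro rfl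
    rw [pow_zero] at hj
    have hu : IsUnit n0 := by
      obtain ⟨u, hu⟩ := hj.symm
      rw [one_mul] at hu
      exact hu ▸ u.isUnit
    exact hprime.ne_top (Ideal.eq_top_of_isUnit_mem _ hn0Q hu)
  exact hπ.dvd_of_dvd_pow ((dvd_pow_self π hjpos).trans (hj.symm.dvd.trans hk'))

/-- The contraction of a prime ideal that is the radical of a principal ideal, along an integral
extension of a unique factorization domain, is principal. -/
theorem exists_prime_comap_eq_span {A B : Type*} [CommRing A] [IsDomain A]
    [UniqueFactorizationMonoid A] [CommRing B] [IsDomain B] [Algebra A B]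
    [Algebra.IsIntegral A B] (hinj : Function.Injective (algebraMap A B))
    {f : B} (hf : f ≠ 0) (Q : Ideal B) [Q.IsPrime] (hfQ : f ∈ Q) (hQ : ∀ x ∈ Q, ∃ k, f ∣ x ^ k) :
    ∃ π : A, Prime π ∧ Q.comap (algebraMap A B) = Ideal.span {π} := by
  have : FaithfulSMul A B := (faithfulSMul_iff_algebraMap_injective A B).mpr hinj
  have : FaithfulSMul A (FractionRing B) := FaithfulSMul.trans A B (FractionRing B)
  let _ : Algebra (FractionRing A) (FractionRing B) := FractionRing.liftAlgebra A (FractionRing B)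
  have : IsScalarTower A (FractionRing A) (FractionRing B) :=
    FractionRing.isScalarTower_liftAlgebra A (FractionRing B)
  exact exists_prime_comap_eq_span_of_isFractionRing (FractionRing A) (FractionRing B) hf Q hfQ hQ

/-! ### The principal ideal theorem for affine domains -/

section DimensionDrop

universe u

theorem trdeg_eq_of_isLocalization_away (L : Type u) {A B : Type u} [Field L] [CommRing A]
    [CommRing B] [IsDomain A] [IsDomain B] [Algebra L A] [Algebra L B] [Algebra A B]
    [IsScalarTower L A B] (hinj : Function.Injective (algebraMap A B)) (g : A)
    (hg : g ≠ 0) (hB : ∀ b : B, ∃ k, ∃ a : A, algebraMap A B (g ^ k) * b = algebraMap A B a) :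
    Algebra.trdeg L A = Algebra.trdeg L B := by
  have : Algebra.IsAlgebraic A B := by
    constructor
    intro b
    obtain ⟨k, a, ha⟩ := hB b
    refine ⟨Polynomial.C (g ^ k) * Polynomial.X - Polynomial.C a, ?_, ?_⟩
    · intro h0
      have h1 := congrArg (Polynomial.coeff · 1) h0
      simp at h1
      rw [← Polynomial.C_pow, Polynomial.coeff_C_zero] at h1
      exact hg (eq_zero_of_pow_eq_zero h1)
    · simp [← ha]
  exact trdeg_eq_of_isAlgebraic L hinj

theorem exists_notMem_forall_mem {R : Type*} [CommRing R] (s : Finset (Ideal R)) (Q : Ideal R)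
    [Q.IsPrime] (h : ∀ P ∈ s, ¬ P ≤ Q) : ∃ g, g ∉ Q ∧ ∀ P ∈ s, g ∈ P := by
  have h1 : ¬ s.inf id ≤ Q := by
    rw [Ideal.IsPrime.inf_le' ‹_›]
    rintro ⟨P, hP, hle⟩
    exact h P hP hle
  obtain ⟨g, hg, hgQ⟩ := SetLike.not_le_iff_exists.mp h1
  refine ⟨g, hgQ, fun P hP => ?_⟩
  exact (Finset.inf_le hP : s.inf id ≤ id P) hg

/-- Inverting an element g that lies in every other minimal prime over f but not in Q makes Q the
radical of (f). Over a Noether normalization of the localization, the contraction of Q is then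
generated by a prime polynomial. Neither the localization nor the integral extension changes
transcendence degrees, so the polynomial case decides. -/
theorem trdeg_quotient_add_one_of_mem_minimalPrimes (L : Type u) {R : Type u} [Field L]
    [CommRing R] [IsDomain R] [Algebra L R] [Algebra.FiniteType L R] {f : R} (hf : f ≠ 0)
    (Q : Ideal R) (hQ : Q ∈ (Ideal.span {f}).minimalPrimes) :
    Algebra.trdeg L (R ⧸ Q) + 1 = Algebra.trdeg L R := by
  classical
  have : IsNoetherianRing R := Algebra.FiniteType.isNoetherianRing L R
  have hQp : Q.IsPrime := hQ.1.1
  have hfQ : f ∈ Q := hQ.1.2 (Ideal.mem_span_singleton_self f)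
  have hfin : (Ideal.span {f}).minimalPrimes.Finite :=
    Ideal.finite_minimalPrimes_of_isNoetherianRing R _
  obtain ⟨g, hgQ, hg⟩ := exists_notMem_forall_mem (hfin.toFinset.erase Q) Q (by
    intro P hP hle
    rw [Finset.mem_erase, Set.Finite.mem_toFinset] at hP
    exact hP.1 (le_antisymm hle (hQ.2 hP.2.1 hle)))
  have hg0 : g ≠ 0 := fun h0 => hgQ (h0 ▸ Q.zero_mem)
  set B := Localization.Away g
  have hM : Submonoid.powers g ≤ nonZeroDivisors R :=
    powers_le_nonZeroDivisors_of_noZeroDivisors hg0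
  have : IsDomain B := IsLocalization.isDomain_localization hM
  have hRB : Function.Injective (algebraMap R B) := IsLocalization.injective B hM
  have hdisj : Disjoint (Submonoid.powers g : Set R) (Q : Set R) := by
    rw [Ideal.disjoint_powers_iff_notMem _ hQp.isRadical]
    exact hgQ
  set Q' : Ideal B := Q.map (algebraMap R B)
  have hQ'p : Q'.IsPrime := IsLocalization.isPrime_of_isPrime_disjoint _ B Q hQp hdisj
  have hcomap : Q'.under R = Q := IsLocalization.under_map_of_isPrime_disjoint _ B hQp hdisj
  have hfrac : ∀ b : B, ∃ k, ∃ a : R, algebraMap R B (g ^ k) * b = algebraMap R B a := by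
    intro b
    obtain ⟨⟨a, ⟨_, k, rfl⟩⟩, hb⟩ := IsLocalization.surj (Submonoid.powers g) b
    exact ⟨k, a, by rw [mul_comm]; exact hb⟩
  have hrad : ∀ x ∈ Q', ∃ k, algebraMap R B f ∣ x ^ k := by
    have hle : Q' ≤ (Ideal.span {algebraMap R B f}).radical := by
      rw [Ideal.radical_eq_sInf]
      refine le_sInf ?_
      rintro P ⟨hfP, hP⟩
      rw [Ideal.span_singleton_le_iff_mem] at hfP
      rw [Ideal.map_le_iff_le_comap]
      have hPc : (P.comap (algebraMap R B)).IsPrime := Ideal.comap_isPrime _ _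
      obtain ⟨Q'', hQ'', hle''⟩ := Ideal.exists_minimalPrimes_le
        (I := Ideal.span {f}) (J := P.comap (algebraMap R B))
        ((Ideal.span_singleton_le_iff_mem _).mpr hfP)
      by_cases heq : Q'' = Q
      · exact heq ▸ hle''
      · exfalso
        have hgP := hle'' (hg Q'' (by simp [heq, hQ'']))
        exact hP.ne_top (Ideal.eq_top_of_isUnit_mem _ hgP
          (IsLocalization.Away.algebraMap_isUnit g))
    intro x hx
    obtain ⟨k, hk⟩ := hle hx
    exact ⟨k, Ideal.mem_span_singleton.mp hk⟩
  have : Algebra.FiniteType R B := IsLocalization.finiteType_of_monoid_fg (Submonoid.powers g) B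
  have : Algebra.FiniteType L B := Algebra.FiniteType.trans (S := R) inferInstance inferInstance
  obtain ⟨s, φ, hφ, hφfin⟩ := exists_finite_inj_algHom_of_fg L B
  let _ : Algebra (MvPolynomial (Fin s) L) B := φ.toRingHom.toAlgebra
  have hfinB : Module.Finite (MvPolynomial (Fin s) L) B := hφfin
  have : IsScalarTower L (MvPolynomial (Fin s) L) B :=
    IsScalarTower.of_algebraMap_eq fun x => (φ.commutes x).symm
  have hAB : Function.Injective (algebraMap (MvPolynomial (Fin s) L) B) := hφ
  obtain ⟨π, hπ, hπQ⟩ := exists_prime_comap_eq_span hAB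
    (f := algebraMap R B f) (by simpa using hf) Q' (Ideal.mem_map_of_mem _ hfQ) hrad
  have h1 : Algebra.trdeg L (MvPolynomial (Fin s) L) = Algebra.trdeg L B :=
    trdeg_eq_of_isAlgebraic L hAB
  have h2 : Algebra.trdeg L R = Algebra.trdeg L B :=
    trdeg_eq_of_isLocalization_away L hRB g hg0 hfrac
  have h3 : Algebra.trdeg L (MvPolynomial (Fin s) L ⧸ Q'.under (MvPolynomial (Fin s) L))
      = Algebra.trdeg L (B ⧸ Q') :=
    trdeg_eq_of_isAlgebraic L (FaithfulSMul.algebraMap_injective _ _)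
  have h4 : Algebra.trdeg L (R ⧸ Q'.under R) = Algebra.trdeg L (B ⧸ Q') := by
    refine trdeg_eq_of_isLocalization_away L (FaithfulSMul.algebraMap_injective _ _)
      (Ideal.Quotient.mk _ g) ?_ ?_
    · rw [Ne, Ideal.Quotient.eq_zero_iff_mem, hcomap]
      exact hgQ
    · intro b
      obtain ⟨b, rfl⟩ := Ideal.Quotient.mk_surjective b
      obtain ⟨k, a, ha⟩ := hfrac b
      refine ⟨k, Ideal.Quotient.mk _ a, ?_⟩
      rw [← map_pow]
      have := congrArg (Ideal.Quotient.mk Q') ha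
      rwa [map_mul] at this
  have h5 : Q'.under (MvPolynomial (Fin s) L) = Ideal.span {π} := hπQ
  rw [h5] at h3
  rw [hcomap] at h4
  rw [h4, ← h3, trdeg_quotient_span_prime hπ, h2, ← h1]
  simp

end DimensionDrop

open MvPolynomial

/-! ### Dimension of prime ideals in polynomial rings -/

section QuotDim

universe u

/-- The transcendence degree of the quotient of a polynomial ring by an ideal. -/
noncomputable def quotDim {L : Type u} [Field L] {σ : Type} (P : Ideal (MvPolynomial σ L)) : ℕ :=
  Cardinal.toNat (Algebra.trdeg L (MvPolynomial σ L ⧸ P))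

variable {L : Type u} [Field L] {σ : Type}

theorem map_mem_minimalPrimes_map {R : Type*} [CommRing R] {P J Q : Ideal R}
    (hQ : Q ∈ (P ⊔ J).minimalPrimes) :
    Q.map (Ideal.Quotient.mk P) ∈ (J.map (Ideal.Quotient.mk P)).minimalPrimes := by
  have hsurj : Function.Surjective (Ideal.Quotient.mk P) := Ideal.Quotient.mk_surjective
  have h1 : (J.map (Ideal.Quotient.mk P)).comap (Ideal.Quotient.mk P) = P ⊔ J := by
    rw [Ideal.comap_map_of_surjective _ hsurj, ← RingHom.ker_eq_comap_bot, Ideal.mk_ker, sup_comm]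
  rw [← h1, Ideal.comap_minimalPrimes_eq_of_surjective hsurj] at hQ
  obtain ⟨Q', hQ', rfl⟩ := hQ
  rwa [Ideal.map_comap_of_surjective _ hsurj]

theorem quotDim_add_one [Finite σ] {P Q : Ideal (MvPolynomial σ L)} [P.IsPrime]
    {f : MvPolynomial σ L} (hf : f ∉ P) (hQ : Q ∈ (P ⊔ Ideal.span {f}).minimalPrimes) :
    quotDim Q + 1 = quotDim P := by
  have hPQ : P ≤ Q := le_sup_left.trans hQ.1.2
  have h1 := map_mem_minimalPrimes_map hQ
  rw [Ideal.map_span, Set.image_singleton] at h1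
  have h2 := trdeg_quotient_add_one_of_mem_minimalPrimes L
    (fun h0 => hf (Ideal.Quotient.eq_zero_iff_mem.mp h0)) _ h1
  have h3 : Algebra.trdeg L ((MvPolynomial σ L ⧸ P) ⧸ Q.map (Ideal.Quotient.mk P))
      = Algebra.trdeg L (MvPolynomial σ L ⧸ Q) :=
    (DoubleQuot.quotQuotEquivQuotOfLEₐ L hPQ).trdeg_eq
  rw [h3] at h2
  have h4 : Algebra.trdeg L (MvPolynomial σ L ⧸ Q) < Cardinal.aleph0 :=
    trdeg_lt_aleph0_of_finiteType
  rw [quotDim, quotDim, ← h2, Cardinal.toNat_add h4 Cardinal.one_lt_aleph0]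
  simp

theorem quotDim_bot [Finite σ] : quotDim (⊥ : Ideal (MvPolynomial σ L)) = Nat.card σ := by
  have h1 : Algebra.trdeg L (MvPolynomial σ L ⧸ (⊥ : Ideal (MvPolynomial σ L)))
      = Algebra.trdeg L (MvPolynomial σ L) := (AlgEquiv.quotientBot L _).trdeg_eq
  rw [quotDim, h1, MvPolynomial.trdeg_of_isDomain, Cardinal.toNat_lift]
  rfl

theorem sub_C_eval_mem {P : Ideal (MvPolynomial σ L)} {v : σ → L}
    (hP : ∀ i, X i - C (v i) ∈ P) (f : MvPolynomial σ L) : f - C (eval v f) ∈ P := by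
  induction f using MvPolynomial.induction_on with
  | C a => simp
  | add p q hp hq =>
    have := P.add_mem hp hq
    rw [map_add, map_add]
    convert this using 1
    ring
  | mul_X p i hp =>
    have := P.add_mem (P.mul_mem_right (X i) hp) (P.mul_mem_left (C (eval v p)) (hP i))
    convert this using 1
    rw [map_mul, eval_X, map_mul]
    ring

theorem quotDim_eq_zero_of_forall_mem {P : Ideal (MvPolynomial σ L)} [P.IsPrime] {v : σ → L}
    (hP : ∀ i, X i - C (v i) ∈ P) : quotDim P = 0 := by
  have : Algebra.IsAlgebraic L (MvPolynomial σ L ⧸ P) := by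
    constructor
    intro x
    obtain ⟨f, rfl⟩ := Ideal.Quotient.mk_surjective x
    have h1 : Ideal.Quotient.mk P f = algebraMap L _ (eval v f) :=
      Ideal.Quotient.eq.mpr (sub_C_eval_mem hP f)
    rw [h1]
    exact isAlgebraic_algebraMap _
  rw [quotDim, trdeg_eq_zero]
  simp

end QuotDim

/-! ### Affine Hilbert functions -/

section Hilbert

variable {L : Type*} [Field L] {σ : Type*}

/-- The image in the quotient by `I` of the polynomials of total degree at most `k`. -/
noncomputable def quotDegreeLE (I : Ideal (MvPolynomial σ L)) (k : ℕ) :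
    Submodule L (MvPolynomial σ L ⧸ I) :=
  (restrictTotalDegree σ L k).map (Ideal.Quotient.mkₐ L I).toLinearMap

/-- The affine Hilbert function of an ideal of a polynomial ring. -/
noncomputable def hilb (I : Ideal (MvPolynomial σ L)) (k : ℕ) : ℕ :=
  Module.finrank L (quotDegreeLE I k)

theorem mem_quotDegreeLE {I : Ideal (MvPolynomial σ L)} {k : ℕ} {x : MvPolynomial σ L ⧸ I} :
    x ∈ quotDegreeLE I k ↔ ∃ p, p.totalDegree ≤ k ∧ Ideal.Quotient.mk I p = x := by
  simp only [quotDegreeLE, Submodule.mem_map, mem_restrictTotalDegree]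
  rfl

/-- The Hilbert function of `I` is at least `w * k ^ d / d!`, up to a shift of the argument. -/
def HilbertLowerBound (I : Ideal (MvPolynomial σ L)) (d : ℕ) (w : ℝ) : Prop :=
  ∃ C : ℕ, ∀ k : ℕ, w * (k : ℝ) ^ d ≤ d.factorial * hilb I (k + C)

theorem HilbertLowerBound.mono {I : Ideal (MvPolynomial σ L)} {d : ℕ} {w w' : ℝ}
    (h : HilbertLowerBound I d w) (hw : w' ≤ w) : HilbertLowerBound I d w' := by
  obtain ⟨C, hC⟩ := h
  exact ⟨C, fun k => (mul_le_mul_of_nonneg_right hw (by positivity)).trans (hC k)⟩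

theorem hilbertLowerBound_of_nonpos (I : Ideal (MvPolynomial σ L)) (d : ℕ) {w : ℝ} (hw : w ≤ 0) :
    HilbertLowerBound I d w :=
  ⟨0, fun k => (mul_nonpos_of_nonpos_of_nonneg hw (by positivity)).trans (by positivity)⟩

variable [Finite σ]

instance (I : Ideal (MvPolynomial σ L)) (k : ℕ) : Module.Finite L (quotDegreeLE I k) := by
  unfold quotDegreeLE
  infer_instance

theorem hilb_mono (I : Ideal (MvPolynomial σ L)) : Monotone (hilb I) := by
  intro k k' h
  refine Submodule.finrank_mono ?_
  intro x hx
  obtain ⟨p, hp, rfl⟩ := mem_quotDegreeLE.mp hx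
  exact mem_quotDegreeLE.mpr ⟨p, hp.trans h, rfl⟩

theorem one_le_hilb {I : Ideal (MvPolynomial σ L)} (hI : I ≠ ⊤) (k : ℕ) : 1 ≤ hilb I k := by
  have : Nontrivial (MvPolynomial σ L ⧸ I) := Ideal.Quotient.nontrivial_iff.mpr hI
  have : Nontrivial (quotDegreeLE I k) :=
    ⟨⟨0, ⟨1, mem_quotDegreeLE.mpr ⟨1, by simp, map_one _⟩⟩, fun h => zero_ne_one
      (congrArg Subtype.val h)⟩⟩
  exact Module.finrank_pos

/-- Cutting the quotient by a prime ideal with a hypersurface of degree at most `δ`. -/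
theorem hilb_add_hilb_sup_span_le {P : Ideal (MvPolynomial σ L)} [P.IsPrime] {f : MvPolynomial σ L}
    (hf : f ∉ P) {δ : ℕ} (hδ : f.totalDegree ≤ δ) (k : ℕ) :
    hilb P k + hilb (P ⊔ Ideal.span {f}) (k + δ) ≤ hilb P (k + δ) := by
  set I := P ⊔ Ideal.span {f}
  have hPI : P ≤ I := le_sup_left
  set φ : (MvPolynomial σ L ⧸ P) →ₗ[L] (MvPolynomial σ L ⧸ I) :=
    (Ideal.Quotient.factorₐ L hPI).toLinearMap
  have hφ : ∀ p, φ (Ideal.Quotient.mk P p) = Ideal.Quotient.mk I p := fun p => rfl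
  set ψ : quotDegreeLE P (k + δ) →ₗ[L] (MvPolynomial σ L ⧸ I) := φ.domRestrict _
  have hrange : LinearMap.range ψ = quotDegreeLE I (k + δ) := by
    ext x
    constructor
    · rintro ⟨⟨y, hy⟩, rfl⟩
      obtain ⟨p, hp, rfl⟩ := mem_quotDegreeLE.mp hy
      exact mem_quotDegreeLE.mpr ⟨p, hp, rfl⟩
    · intro hx
      obtain ⟨p, hp, rfl⟩ := mem_quotDegreeLE.mp hx
      exact ⟨⟨Ideal.Quotient.mk P p, mem_quotDegreeLE.mpr ⟨p, hp, rfl⟩⟩, rfl⟩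
  -- Multiplication by f is injective modulo the prime P and lands in the kernel of ψ, so
  -- rank-nullity gives the inequality. The kernel may be larger than this image.
  set μ : quotDegreeLE P k →ₗ[L] quotDegreeLE P (k + δ) :=
    LinearMap.codRestrict _ ((LinearMap.mulLeft L (Ideal.Quotient.mk P f)).domRestrict _) (by
      rintro ⟨y, hy⟩
      obtain ⟨p, hp, rfl⟩ := mem_quotDegreeLE.mp hy
      refine mem_quotDegreeLE.mpr ⟨f * p, ?_, ?_⟩
      · exact (totalDegree_mul f p).trans (by omega)
      · simp)
  have hμ : Function.Injective μ := by
    intro a b hab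
    have h1 : Ideal.Quotient.mk P f * a.1 = Ideal.Quotient.mk P f * b.1 :=
      congrArg Subtype.val hab
    exact Subtype.ext (mul_left_cancel₀
      (fun h0 => hf (Ideal.Quotient.eq_zero_iff_mem.mp h0)) h1)
  have hker : LinearMap.range μ ≤ LinearMap.ker ψ := by
    rintro _ ⟨⟨y, hy⟩, rfl⟩
    obtain ⟨p, hp, rfl⟩ := mem_quotDegreeLE.mp hy
    rw [LinearMap.mem_ker]
    change φ (Ideal.Quotient.mk P f * Ideal.Quotient.mk P p) = 0
    rw [← map_mul, hφ, Ideal.Quotient.eq_zero_iff_mem]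
    exact I.mul_mem_right _ (le_sup_right (a := P) (Ideal.mem_span_singleton_self f))
  have h1 := LinearMap.finrank_range_add_finrank_ker ψ
  have h2 := Submodule.finrank_mono hker
  rw [LinearMap.finrank_range_of_inj hμ] at h2
  rw [hrange] at h1
  unfold hilb
  omega

/-- The Hilbert functions of pairwise incomparable primes over an ideal add up. -/
theorem exists_sum_hilb_le (I : Ideal (MvPolynomial σ L)) (s : Finset (Ideal (MvPolynomial σ L)))
    (hs : ∀ Q ∈ s, Q ∈ I.minimalPrimes) :
    ∃ c, ∀ k, ∑ Q ∈ s, hilb Q k ≤ hilb I (k + c) := by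
  classical
  have hg : ∀ Q : s, ∃ g : MvPolynomial σ L, g ∉ Q.1 ∧ ∀ P ∈ s.erase Q.1, g ∈ P := by
    intro Q
    have : Q.1.IsPrime := (hs Q.1 Q.2).1.1
    refine exists_notMem_forall_mem _ _ fun P hP hle => ?_
    rw [Finset.mem_erase] at hP
    exact hP.1 (le_antisymm hle ((hs Q.1 Q.2).2 (hs P hP.2).1 hle))
  choose g hgQ hg using hg
  refine ⟨Finset.univ.sup fun Q => (g Q).totalDegree, fun k => ?_⟩
  set c := Finset.univ.sup fun Q => (g Q).totalDegree
  have hc : ∀ Q, (g Q).totalDegree ≤ c := fun Q =>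
    Finset.le_sup (f := fun Q => (g Q).totalDegree) (Finset.mem_univ Q)
  set φ : (MvPolynomial σ L ⧸ I) →ₗ[L] (∀ Q : s, MvPolynomial σ L ⧸ Q.1) :=
    LinearMap.pi fun Q => (Ideal.Quotient.factorₐ L (hs Q.1 Q.2).1.2).toLinearMap
  -- Each g Q lies in all the other primes of s but not in Q. So (p_Q) ↦ (g_Q p_Q) is injective, and
  -- its value is the image of the single polynomial ∑ g_Q p_Q; the price is the shift c, the
  -- largest degree of a g_Q.
  set ψ : (∀ Q : s, quotDegreeLE Q.1 k) →ₗ[L] (∀ Q : s, MvPolynomial σ L ⧸ Q.1) :=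
    LinearMap.pi fun Q => (LinearMap.mulLeft L (Ideal.Quotient.mk Q.1 (g Q))) ∘ₗ
      (quotDegreeLE Q.1 k).subtype ∘ₗ LinearMap.proj Q
  have hψ : Function.Injective ψ := by
    intro a b hab
    funext Q
    have : Q.1.IsPrime := (hs Q.1 Q.2).1.1
    have h1 : Ideal.Quotient.mk Q.1 (g Q) * (a Q).1 = Ideal.Quotient.mk Q.1 (g Q) * (b Q).1 :=
      congrFun hab Q
    exact Subtype.ext (mul_left_cancel₀
      (fun h0 => hgQ Q (Ideal.Quotient.eq_zero_iff_mem.mp h0)) h1)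
  have hle : LinearMap.range ψ ≤ (quotDegreeLE I (k + c)).map φ := by
    rintro _ ⟨a, rfl⟩
    have ha : ∀ Q : s, ∃ p, p.totalDegree ≤ k ∧ Ideal.Quotient.mk Q.1 p = (a Q).1 :=
      fun Q => mem_quotDegreeLE.mp (a Q).2
    choose p hp hpa using ha
    refine ⟨Ideal.Quotient.mk I (∑ Q, g Q * p Q), mem_quotDegreeLE.mpr ⟨_, ?_, rfl⟩, ?_⟩
    · refine totalDegree_finsetSum_le fun Q _ => (totalDegree_mul _ _).trans ?_
      have := hp Q
      have := hc Q
      omega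
    · funext Q
      change Ideal.Quotient.mk Q.1 (∑ Q, g Q * p Q) = Ideal.Quotient.mk Q.1 (g Q) * (a Q).1
      rw [map_sum, Finset.sum_eq_single Q, map_mul, hpa]
      · intro Q' _ hne
        rw [Ideal.Quotient.eq_zero_iff_mem]
        refine Q.1.mul_mem_right _ (hg Q' Q.1 ?_)
        rw [Finset.mem_erase]
        exact ⟨fun h => hne (Subtype.ext h.symm), Q.2⟩
      · simp
  have h1 := Submodule.finrank_mono hle
  have hfree : ∀ Q : s, Module.Free L (quotDegreeLE Q.1 k) := fun Q =>
    Module.Free.of_divisionRing _ _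
  rw [LinearMap.finrank_range_of_inj hψ, Module.finrank_pi_fintype] at h1
  have h2 := Submodule.finrank_map_le φ (quotDegreeLE I (k + c))
  rw [← Finset.sum_coe_sort]
  exact h1.trans h2

theorem hilbertLowerBound_zero_one {I : Ideal (MvPolynomial σ L)} (hI : I ≠ ⊤) :
    HilbertLowerBound I 0 1 :=
  ⟨0, fun k => by simpa using one_le_hilb hI k⟩

/-- The mean value inequality for x ↦ x^(d+1), by induction on d. -/
theorem pow_succ_le_pow_succ_add {x y : ℝ} (hy : 0 ≤ y) (hxy : y ≤ x) (d : ℕ) :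
    x ^ (d + 1) ≤ y ^ (d + 1) + (d + 1) * x ^ d * (x - y) := by
  induction d with
  | zero => simp
  | succ d ih =>
    have h1 : y ^ (d + 1) ≤ x ^ (d + 1) := pow_le_pow_left₀ hy hxy _
    have h2 := mul_le_mul_of_nonneg_left ih (hy.trans hxy)
    have h3 := mul_le_mul_of_nonneg_right h1 (sub_nonneg.mpr hxy)
    push_cast
    have e1 : x ^ (d + 1 + 1) = x * x ^ (d + 1) := by ring
    have e2 : y ^ (d + 1 + 1) = y * y ^ (d + 1) := by ring
    have e3 : x * (y ^ (d + 1) + (d + 1) * x ^ d * (x - y))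
      = x * y ^ (d + 1) + (d + 1) * x ^ (d + 1) * (x - y) := by ring
    rw [e3] at h2
    rw [e1, e2]
    nlinarith

/-- Discrete integration: over a step δ, the increment of a dominates that of w/δ · k^(d+1). The
hypothesis `h0` starts the induction in every residue class modulo δ. -/
theorem mul_pow_succ_le_of_add_le {a : ℕ → ℝ} {w : ℝ} {d δ : ℕ} (hw : 0 ≤ w) (hδ : 1 ≤ δ)
    (h0 : ∀ k : ℕ, (d + 1) * (w * (k : ℝ) ^ d) ≤ a k)
    (h1 : ∀ k : ℕ, a k + (d + 1) * (w * ((k + δ : ℕ) : ℝ) ^ d) ≤ a (k + δ)) (k : ℕ) :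
    w / δ * (k : ℝ) ^ (d + 1) ≤ a k := by
  have hδ' : (0 : ℝ) < δ := by exact_mod_cast hδ
  induction k using Nat.strong_induction_on with
  | _ k ih =>
    by_cases hk : k < δ
    · refine le_trans ?_ (h0 k)
      have h2 : (k : ℝ) ≤ δ := by exact_mod_cast hk.le
      have h3 : w / δ * (k : ℝ) ^ (d + 1) = w * (k : ℝ) ^ d * (k / δ) := by
        field_simp
        ring
      rw [h3]
      have h4 : (k : ℝ) / δ ≤ 1 := (div_le_one hδ').mpr h2
      have h5 : 0 ≤ w * (k : ℝ) ^ d := by positivity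
      have h6 : 0 ≤ (d : ℝ) := by positivity
      nlinarith
    · obtain ⟨j, rfl⟩ := Nat.exists_eq_add_of_le' (not_lt.mp hk)
      have h2 := ih j (by omega)
      refine le_trans ?_ ((add_le_add_left h2 _).trans (h1 j))
      have h3 := pow_succ_le_pow_succ_add (x := ((j + δ : ℕ) : ℝ)) (y := (j : ℝ))
        (by positivity) (by push_cast; linarith) d
      have h4 := mul_le_mul_of_nonneg_left h3 (show 0 ≤ w / δ by positivity)
      refine h4.trans (le_of_eq ?_)
      have h5 : ((j + δ : ℕ) : ℝ) - j = δ := by push_cast; ring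
      rw [h5]
      field_simp

/-- Bézout's inequality for a prime and a hypersurface, in terms of Hilbert functions. -/
theorem HilbertLowerBound.of_minimalPrimes {P : Ideal (MvPolynomial σ L)} [P.IsPrime]
    {f : MvPolynomial σ L} (hf : f ∉ P) {δ : ℕ} (hδ : f.totalDegree ≤ δ) (hδ1 : 1 ≤ δ)
    (s : Finset (Ideal (MvPolynomial σ L)))
    (hs : ∀ Q ∈ s, Q ∈ (P ⊔ Ideal.span {f}).minimalPrimes) (d : ℕ)
    (w : Ideal (MvPolynomial σ L) → ℝ) (hw : ∀ Q ∈ s, 0 ≤ w Q)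
    (hLB : ∀ Q ∈ s, HilbertLowerBound Q d (w Q)) :
    HilbertLowerBound P (d + 1) ((∑ Q ∈ s, w Q) / δ) := by
  classical
  obtain ⟨c, hc⟩ := exists_sum_hilb_le _ s hs
  have hC : ∀ Q : s, ∃ C : ℕ, ∀ k : ℕ, w Q * (k : ℝ) ^ d ≤ d.factorial * hilb Q.1 (k + C) :=
    fun Q => hLB Q.1 Q.2
  choose C hC using hC
  set C0 := Finset.univ.sup C
  have hC0 : ∀ Q, C Q ≤ C0 := fun Q => Finset.le_sup (Finset.mem_univ Q)
  have hsum : ∀ k : ℕ, (∑ Q ∈ s, w Q) * (k : ℝ) ^ d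
      ≤ d.factorial * ∑ Q ∈ s, (hilb Q (k + C0) : ℝ) := by
    intro k
    rw [Finset.sum_mul, Finset.mul_sum]
    refine Finset.sum_le_sum fun Q hQ => (hC ⟨Q, hQ⟩ k).trans ?_
    have : hilb Q (k + C ⟨Q, hQ⟩) ≤ hilb Q (k + C0) := hilb_mono Q (by have := hC0 ⟨Q, hQ⟩; omega)
    gcongr
  have hstep : ∀ k : ℕ, (hilb P (k + C0 + c) : ℝ) + ∑ Q ∈ s, (hilb Q (k + C0 + δ) : ℝ)
      ≤ hilb P (k + C0 + c + δ) := by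
    intro k
    have h1 := hilb_add_hilb_sup_span_le hf hδ (k + C0 + c)
    have h2 := hc (k + C0 + δ)
    rw [show k + C0 + δ + c = k + C0 + c + δ by ring] at h2
    exact_mod_cast (by omega : hilb P (k + C0 + c) + ∑ Q ∈ s, hilb Q (k + C0 + δ)
      ≤ hilb P (k + C0 + c + δ))
  have hmain : ∀ k : ℕ, ((d + 1).factorial : ℝ) * hilb P (k + C0 + c)
      + (d + 1) * ((∑ Q ∈ s, w Q) * ((k + δ : ℕ) : ℝ) ^ d)
      ≤ ((d + 1).factorial : ℝ) * hilb P (k + C0 + c + δ) := by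
    intro k
    have h1 := hsum (k + δ)
    rw [show k + δ + C0 = k + C0 + δ by ring] at h1
    have h2 := mul_le_mul_of_nonneg_left (hstep k)
      (show (0 : ℝ) ≤ ((d + 1).factorial : ℝ) by positivity)
    have h3 := mul_le_mul_of_nonneg_left h1 (show (0 : ℝ) ≤ (d : ℝ) + 1 by positivity)
    refine le_trans ?_ h2
    rw [mul_add, Nat.factorial_succ]
    push_cast at h3 ⊢
    linarith
  -- The extra shift by δ makes the shifted function dominate one full increment from the start,
  -- which is what `h0` of `mul_pow_succ_le_of_add_le` requires.
  refine ⟨C0 + c + δ, fun k => ?_⟩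
  refine mul_pow_succ_le_of_add_le (a := fun k => ((d + 1).factorial : ℝ) * hilb P (k + (C0 + c + δ)))
    (Finset.sum_nonneg hw) hδ1 ?_ ?_ k
  · intro k
    have h1 := hmain k
    have h2 : (0 : ℝ) ≤ ((d + 1).factorial : ℝ) * hilb P (k + C0 + c) := by positivity
    have h3 : ((k : ℕ) : ℝ) ^ d ≤ ((k + δ : ℕ) : ℝ) ^ d := by
      gcongr; omega
    have h4 := mul_le_mul_of_nonneg_left h3 (Finset.sum_nonneg hw)
    have h5 := mul_le_mul_of_nonneg_left h4 (show (0 : ℝ) ≤ (d : ℝ) + 1 by positivity)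
    simp only [← add_assoc]
    linarith
  · intro k
    have h1 := hmain (k + δ)
    have h3 : ((k + δ : ℕ) : ℝ) ^ d ≤ ((k + δ + δ : ℕ) : ℝ) ^ d := by
      gcongr; omega
    have h4 := mul_le_mul_of_nonneg_left h3 (Finset.sum_nonneg hw)
    have h5 := mul_le_mul_of_nonneg_left h4 (show (0 : ℝ) ≤ (d : ℝ) + 1 by positivity)
    simp only [← add_assoc]
    rw [show k + C0 + c + δ = k + δ + C0 + c by ring]
    linarith

end Hilbert

/-! ### Bézout's inequality for several hypersurfaces -/

section Bezout

theorem hilb_bot_le {L : Type*} [Field L] {σ : Type*} [Finite σ] (k : ℕ) :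
    (Nat.card σ).factorial * hilb (⊥ : Ideal (MvPolynomial σ L)) k
      ≤ (k + Nat.card σ) ^ Nat.card σ := by
  classical
  have := Fintype.ofFinite σ
  set s : Set (σ →₀ ℕ) := {n | (n.sum fun _ e => e) ≤ k}
  set T := (Finset.univ : Finset (Option σ)).finsuppAntidiag k
  have h1 : hilb (⊥ : Ideal (MvPolynomial σ L)) k ≤ Nat.card s := by
    refine (Submodule.finrank_map_le _ _).trans (le_of_eq ?_)
    exact Module.finrank_eq_nat_card_basis (basisRestrictSupport L s)
  -- A slack variable turns exponents of total degree at most k into exponents of degree exactly k,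
  -- which a binomial coefficient counts.
  set F : (σ →₀ ℕ) → (Option σ →₀ ℕ) := fun n =>
    Finsupp.equivFunOnFinite.symm fun o => o.elim (k - n.sum fun _ e => e) n
  have hF : ∀ n ∈ s, F n ∈ T := by
    intro n hn
    rw [Finset.mem_finsuppAntidiag]
    refine ⟨?_, Finset.subset_univ _⟩
    have h2 : (n.sum fun _ e => e) = ∑ i, n i := Finsupp.sum_fintype _ _ (by simp)
    have h3 : (n.sum fun _ e => e) ≤ k := hn
    rw [Fintype.sum_option]
    simp only [F, Finsupp.equivFunOnFinite_symm_apply_apply, Option.elim]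
    omega
  have hinj : Function.Injective F := by
    intro n m h
    ext i
    exact DFunLike.congr_fun h (some i)
  have h2 : Nat.card s ≤ T.card := by
    have := Nat.card_le_card_of_injective (fun n : s => (⟨F n, hF n n.2⟩ : T))
      (fun a b h => Subtype.ext (hinj (congrArg Subtype.val h)))
    simpa using this
  rw [Finset.card_finsuppAntidiag_nat_eq_choose, Finset.card_univ, Fintype.card_option] at h2
  have h3 : (Fintype.card σ + 1 + k - 1).choose k = (k + Nat.card σ).choose (Nat.card σ) := by
    rw [Nat.card_eq_fintype_card, show Fintype.card σ + 1 + k - 1 = k + Fintype.card σ by omega]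
    exact Nat.choose_symm_add
  rw [h3] at h2
  calc _ ≤ (Nat.card σ).factorial * (k + Nat.card σ).choose (Nat.card σ) :=
        Nat.mul_le_mul_left _ (h1.trans h2)
    _ = (k + Nat.card σ).descFactorial (Nat.card σ) :=
        (Nat.descFactorial_eq_factorial_mul_choose _ _).symm
    _ ≤ _ := Nat.descFactorial_le_pow _ _

/-- Affine space has degree one: divide by k^N and let k tend to infinity. -/
theorem HilbertLowerBound.le_one {L : Type*} [Field L] {σ : Type*} [Finite σ] {w : ℝ}
    (h : HilbertLowerBound (⊥ : Ideal (MvPolynomial σ L)) (Nat.card σ) w) : w ≤ 1 := by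
  obtain ⟨C, hC⟩ := h
  set N := Nat.card σ
  have h1 : ∀ k : ℕ, 1 ≤ k → w ≤ (1 + ((C + N : ℕ) : ℝ) / k) ^ N := by
    intro k hk
    have hk' : (0 : ℝ) < k := by exact_mod_cast hk
    have h2 : w * (k : ℝ) ^ N ≤ ((k + (C + N) : ℕ) : ℝ) ^ N := by
      refine (hC k).trans ?_
      rw [← add_assoc]
      exact_mod_cast hilb_bot_le (L := L) (σ := σ) (k + C)
    have h3 : (1 + ((C + N : ℕ) : ℝ) / k) ^ N = ((k + (C + N) : ℕ) : ℝ) ^ N / (k : ℝ) ^ N := by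
      rw [← div_pow]
      congr 1
      rw [Nat.cast_add k]
      field_simp
    rw [h3]
    exact (le_div_iff₀ (pow_pos hk' N)).mpr h2
  have h2 : Filter.Tendsto (fun k : ℕ => (1 + ((C + N : ℕ) : ℝ) / k) ^ N) Filter.atTop
      (nhds ((1 + 0) ^ N)) :=
    ((tendsto_const_nhds).add (tendsto_const_div_atTop_nhds_zero_nat _)).pow N
  simp only [add_zero, one_pow] at h2
  exact ge_of_tendsto h2 (Filter.eventually_atTop.mpr ⟨1, h1⟩)

universe u

variable {L : Type u} [Field L] {σ : Type} [Finite σ]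

/-- Bézout's inequality for a prime and a list of hypersurfaces, in terms of Hilbert functions. -/
theorem HilbertLowerBound.of_minimalPrimes_ofList (l : List (MvPolynomial σ L × ℕ))
    (hl : ∀ p ∈ l, p.1.totalDegree ≤ p.2 ∧ 1 ≤ p.2) (P : Ideal (MvPolynomial σ L)) [P.IsPrime]
    (s : Finset (Ideal (MvPolynomial σ L)))
    (hs : ∀ Q ∈ s, Q ∈ (P ⊔ Ideal.ofList (l.map Prod.fst)).minimalPrimes)
    (w : Ideal (MvPolynomial σ L) → ℝ) (hw : ∀ Q ∈ s, 0 ≤ w Q)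
    (hLB : ∀ Q ∈ s, HilbertLowerBound Q (quotDim Q) (w Q)) :
    HilbertLowerBound P (quotDim P) ((∑ Q ∈ s, w Q) / (l.map Prod.snd).prod) := by
  classical
  induction l generalizing P s with
  | nil =>
    have hsP : ∀ Q ∈ s, Q = P := by
      intro Q hQ
      have h1 := hs Q hQ
      simp only [List.map_nil, Ideal.ofList_nil, sup_bot_eq,
        Ideal.minimalPrimes_eq_subsingleton_self] at h1
      exact h1
    rcases s.eq_empty_or_nonempty with rfl | ⟨Q, hQ⟩
    · exact hilbertLowerBound_of_nonpos _ _ (by simp)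
    · obtain rfl := hsP Q hQ
      have h2 : s = {Q} := Finset.eq_singleton_iff_unique_mem.mpr ⟨hQ, hsP⟩
      rw [h2]
      simpa using hLB Q hQ
  | cons p l ih =>
    obtain ⟨f, δ⟩ := p
    obtain ⟨hdeg, hδ⟩ := hl _ List.mem_cons_self
    have hl' : ∀ p ∈ l, p.1.totalDegree ≤ p.2 ∧ 1 ≤ p.2 := fun p hp =>
      hl p (List.mem_cons_of_mem _ hp)
    have hδ' : (1 : ℝ) ≤ δ := by exact_mod_cast hδ
    simp only [List.map_cons, Ideal.ofList_cons, List.prod_cons] at hs ⊢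
    -- An equation already in P cuts nothing; dropping it gives a stronger bound, because δ ≥ 1.
    by_cases hf : f ∈ P
    · have h1 : P ⊔ (Ideal.span {f} ⊔ Ideal.ofList (l.map Prod.fst))
          = P ⊔ Ideal.ofList (l.map Prod.fst) := by
        rw [← sup_assoc, sup_eq_left.mpr ((Ideal.span_singleton_le_iff_mem _).mpr hf)]
      rw [h1] at hs
      refine (ih hl' P s hs hw hLB).mono ?_
      rw [Nat.cast_mul, mul_comm, ← div_div]
      exact div_le_self (div_nonneg (Finset.sum_nonneg hw) (by positivity)) hδ'
    · rcases s.eq_empty_or_nonempty with rfl | hne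
      · exact hilbertLowerBound_of_nonpos _ _ (by simp)
      -- Each Q contains a component c Q of the first cut and stays minimal over c Q plus the
      -- remaining equations. Grouping the Q by c Q lets the induction hypothesis give a weight to
      -- each P'.
      have hex : ∀ Q : s, ∃ P' ∈ (P ⊔ Ideal.span {f}).minimalPrimes, P' ≤ Q.1 := fun Q => by
        have := (hs Q.1 Q.2).1.1
        exact Ideal.exists_minimalPrimes_le
          ((sup_le_sup_left le_sup_left _).trans (hs Q.1 Q.2).1.2)
      choose! c hcmin hcle using fun Q (hQ : Q ∈ s) => hex ⟨Q, hQ⟩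
      set t := s.image c
      have ht : ∀ P' ∈ t, P' ∈ (P ⊔ Ideal.span {f}).minimalPrimes := by
        intro P' hP'
        obtain ⟨Q, hQ, rfl⟩ := Finset.mem_image.mp hP'
        exact hcmin Q hQ
      set W : Ideal (MvPolynomial σ L) → ℝ := fun P' =>
        (∑ Q ∈ s with c Q = P', w Q) / (l.map Prod.snd).prod
      have hW : ∀ P' ∈ t, HilbertLowerBound P' (quotDim P') (W P') := by
        intro P' hP'
        have : P'.IsPrime := (ht P' hP').1.1
        refine ih hl' P' _ ?_ ?_ ?_
        · intro Q hQ
          obtain ⟨hQs, rfl⟩ := Finset.mem_filter.mp hQ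
          have h1 := hs Q hQs
          refine ⟨⟨h1.1.1, sup_le (hcle Q hQs) ?_⟩, ?_⟩
          · exact (le_sup_right.trans le_sup_right).trans h1.1.2
          · rintro Q' ⟨hQ'p, hQ'⟩ hle
            refine h1.2 ⟨hQ'p, ?_⟩ hle
            refine sup_le ?_ (sup_le ?_ (le_sup_right.trans hQ'))
            · exact le_sup_left.trans ((hcmin Q hQs).1.2.trans (le_sup_left.trans hQ'))
            · exact le_sup_right.trans ((hcmin Q hQs).1.2.trans (le_sup_left.trans hQ'))
        · exact fun Q hQ => hw Q (Finset.mem_filter.mp hQ).1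
        · exact fun Q hQ => hLB Q (Finset.mem_filter.mp hQ).1
      -- The Q may differ in dimension, but all components of the first cut have the same one, so
      -- the inequality for a single hypersurface applies to the weights W.
      have hdim : ∀ P' ∈ t, quotDim P' + 1 = quotDim P := fun P' hP' =>
        quotDim_add_one hf (ht P' hP')
      obtain ⟨P0, hP0⟩ : t.Nonempty := hne.image c
      have hB := HilbertLowerBound.of_minimalPrimes hf hdeg hδ t ht (quotDim P0) W
        (fun P' _ => div_nonneg (Finset.sum_nonneg fun Q hQ => hw Q (Finset.mem_filter.mp hQ).1)
          (by positivity))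
        (fun P' hP' => by
          have := hdim P' hP'
          have := hdim P0 hP0
          rw [show quotDim P0 = quotDim P' by omega]
          exact hW P' hP')
      rw [hdim P0 hP0] at hB
      convert hB using 1
      simp only [W]
      rw [← Finset.sum_div, Finset.sum_fiberwise_of_maps_to
        (fun Q hQ => Finset.mem_image_of_mem c hQ)]
      push_cast
      rw [mul_comm, div_div]

theorem sum_le_prod_of_hilbertLowerBound (l : List (MvPolynomial σ L × ℕ))
    (hl : ∀ p ∈ l, p.1.totalDegree ≤ p.2 ∧ 1 ≤ p.2)
    (s : Finset (Ideal (MvPolynomial σ L)))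
    (hs : ∀ Q ∈ s, Q ∈ (Ideal.ofList (l.map Prod.fst)).minimalPrimes)
    (w : Ideal (MvPolynomial σ L) → ℝ) (hw : ∀ Q ∈ s, 0 ≤ w Q)
    (hLB : ∀ Q ∈ s, HilbertLowerBound Q (quotDim Q) (w Q)) :
    ∑ Q ∈ s, w Q ≤ (l.map Prod.snd).prod := by
  have hprime : (⊥ : Ideal (MvPolynomial σ L)).IsPrime := Ideal.isPrime_bot
  have h1 := HilbertLowerBound.of_minimalPrimes_ofList l hl ⊥ s (by simpa using hs) w hw hLB
  rw [quotDim_bot] at h1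
  have hpos : (0 : ℝ) < (l.map Prod.snd).prod := by
    have : 0 < (l.map Prod.snd).prod := by
      refine List.prod_pos ?_
      intro a ha
      obtain ⟨p, hp, rfl⟩ := List.mem_map.mp ha
      exact (hl p hp).2
    exact_mod_cast this
  exact (div_le_one hpos).mp h1.le_one

end Bezout

/-! ### Rational points over a finite field -/

section Counting

universe u

/-- The zeros of an ideal with coordinates in a subfield. -/
def rationalZeros (K : Type*) [Field K] {L : Type*} [Field L] [Algebra K L] {σ : Type*}
    (P : Ideal (MvPolynomial σ L)) : Set (σ → K) :=
  {v | ∀ f ∈ P, eval (fun i => algebraMap K L (v i)) f = 0}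

/-- The trivial upper bound for the number of rational points, in terms of Hilbert functions. -/
theorem hilbertLowerBound_ncard_rationalZeros (K : Type*) [Field K] [Finite K] {L : Type u}
    [Field L] [Algebra K L] {σ : Type} [Finite σ] (P : Ideal (MvPolynomial σ L)) [P.IsPrime] :
    HilbertLowerBound P (quotDim P)
      ((rationalZeros K P).ncard / (Nat.card K : ℝ) ^ quotDim P) := by
  classical
  have := Fintype.ofFinite K
  have := Fintype.ofFinite σ
  have hq : (0 : ℝ) < Nat.card K := by exact_mod_cast Nat.card_pos
  induction hd : quotDim P generalizing P with
  | zero =>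
    refine (hilbertLowerBound_zero_one (Ideal.IsPrime.ne_top ‹_›)).mono ?_
    rw [pow_zero, div_one]
    have h1 : (rationalZeros K P).ncard ≤ 1 := by
      rw [Set.ncard_le_one]
      intro v hv v' hv'
      -- If one of these linear polynomials were outside P, cutting with it would give a prime of
      -- dimension below zero. So P determines all coordinates of its rational zero.
      have key : ∀ i, X i - C (algebraMap K L (v i)) ∈ P := by
        intro i
        by_contra hf
        have h2 : P ⊔ Ideal.span {X i - C (algebraMap K L (v i))}
            ≤ RingHom.ker (eval fun i => algebraMap K L (v i)) := by
          refine sup_le hv ?_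
          rw [Ideal.span_singleton_le_iff_mem, RingHom.mem_ker]
          simp
        have : (RingHom.ker (eval fun i => algebraMap K L (v i))).IsPrime := RingHom.ker_isPrime _
        obtain ⟨Q, hQ, -⟩ := Ideal.exists_minimalPrimes_le h2
        have := quotDim_add_one hf hQ
        omega
      funext i
      have h2 := hv' _ (key i)
      simp only [map_sub, eval_X, eval_C, sub_eq_zero] at h2
      exact ((algebraMap K L).injective h2).symm
    exact_mod_cast h1
  | succ d ih =>
    rcases (rationalZeros K P).eq_empty_or_nonempty with h0 | ⟨p, hp⟩
    · exact hilbertLowerBound_of_nonpos _ _ (by simp [h0])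
    -- In positive dimension some coordinate is not constant. The q slices X_i = a with a ∈ K
    -- contain all rational zeros, none contains the zero set of P, and the richest slice has at
    -- least a fraction 1/q of the points. Cutting with a hyperplane loses nothing, as δ = 1.
    obtain ⟨i, hi⟩ : ∃ i, X i - C (algebraMap K L (p i)) ∉ P := by
      by_contra! hcon
      have := quotDim_eq_zero_of_forall_mem (v := fun i => algebraMap K L (p i)) hcon
      omega
    have hnot : ∀ a : K, X i - C (algebraMap K L a) ∉ P := by
      intro a ha
      have h1 := hp _ ha
      simp only [map_sub, eval_X, eval_C, sub_eq_zero] at h1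
      exact hi ((algebraMap K L).injective h1 ▸ ha)
    have hfin : ∀ a : K, (P ⊔ Ideal.span {X i - C (algebraMap K L a)}).minimalPrimes.Finite :=
      fun a => Ideal.finite_minimalPrimes_of_isNoetherianRing _ _
    set t : K → Finset (Ideal (MvPolynomial σ L)) := fun a => (hfin a).toFinset
    have ht : ∀ a, ∀ Q ∈ t a, Q ∈ (P ⊔ Ideal.span {X i - C (algebraMap K L a)}).minimalPrimes :=
      fun a Q hQ => (hfin a).mem_toFinset.mp hQ
    have hcover : (rationalZeros K P).ncard ≤ ∑ a, ∑ Q ∈ t a, (rationalZeros K Q).ncard := by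
      have h1 : (rationalZeros K P).toFinite.toFinset ⊆ Finset.univ.biUnion fun a =>
          (t a).biUnion fun Q => (rationalZeros K Q).toFinite.toFinset := by
        intro v hv
        rw [Set.Finite.mem_toFinset] at hv
        simp only [Finset.mem_biUnion, Finset.mem_univ, true_and, Set.Finite.mem_toFinset]
        have h2 : P ⊔ Ideal.span {X i - C (algebraMap K L (v i))}
            ≤ RingHom.ker (eval fun i => algebraMap K L (v i)) := by
          refine sup_le hv ?_
          rw [Ideal.span_singleton_le_iff_mem, RingHom.mem_ker]
          simp
        have : (RingHom.ker (eval fun i => algebraMap K L (v i))).IsPrime := RingHom.ker_isPrime _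
        obtain ⟨Q, hQ, hle⟩ := Ideal.exists_minimalPrimes_le h2
        exact ⟨v i, Q, (hfin _).mem_toFinset.mpr hQ, fun f hf => hle hf⟩
      rw [Set.ncard_eq_toFinset_card _]
      refine (Finset.card_le_card h1).trans (Finset.card_biUnion_le.trans ?_)
      refine Finset.sum_le_sum fun a _ => Finset.card_biUnion_le.trans ?_
      refine Finset.sum_le_sum fun Q _ => ?_
      rw [Set.ncard_eq_toFinset_card _]
    obtain ⟨a, -, ha⟩ := Finset.exists_max_image (Finset.univ : Finset K)
      (fun a => ∑ Q ∈ t a, (rationalZeros K Q).ncard) Finset.univ_nonempty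
    have hle : (rationalZeros K P).ncard
        ≤ Nat.card K * ∑ Q ∈ t a, (rationalZeros K Q).ncard := by
      refine hcover.trans ((Finset.sum_le_card_nsmul _ _ _ fun b hb => ha b hb).trans ?_)
      rw [Nat.card_eq_fintype_card, smul_eq_mul, Finset.card_univ]
    have hdim : ∀ Q ∈ t a, quotDim Q = d := by
      intro Q hQ
      have := quotDim_add_one (hnot a) (ht a Q hQ)
      omega
    have hB := HilbertLowerBound.of_minimalPrimes (hnot a) (δ := 1)
      ((totalDegree_sub_C_le _ _).trans (totalDegree_X _).le) le_rfl (t a) (ht a) d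
      (fun Q => (rationalZeros K Q).ncard / (Nat.card K : ℝ) ^ d)
      (fun Q _ => by positivity)
      (fun Q hQ => by
        have : Q.IsPrime := (ht a Q hQ).1.1
        exact ih Q (hdim Q hQ))
    refine hB.mono ?_
    rw [Nat.cast_one, div_one, ← Finset.sum_div, pow_succ, ← div_div, div_right_comm]
    refine div_le_div_of_nonneg_right ?_ (by positivity)
    rw [div_le_iff₀ hq, mul_comm]
    exact_mod_cast hle

end Counting

/-! ### Homogeneous ideals and closed subsets of projective space -/

namespace ProjSpace

open MvPolynomial

attribute [local instance] MvPolynomial.gradedAlgebra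

variable {L : Type*} [Field L] {ι : Type*}

theorem eval_smul_of_isHomogeneous {f : MvPolynomial ι L} {m : ℕ} (hf : f.IsHomogeneous m) (a : L)
    (v : ι → L) : eval (a • v) f = a ^ m * eval v f := by
  rw [eval_eq, eval_eq, Finset.mul_sum]
  refine Finset.sum_congr rfl fun s hs => ?_
  have hdeg : ∑ i ∈ s.support, s i = m := by
    have := hf (mem_support_iff.mp hs)
    rwa [Finsupp.weight_apply, Finsupp.sum, Finset.sum_congr rfl
      (fun i _ => by simp : ∀ i ∈ s.support, s i • (1 : ι → ℕ) i = s i)] at this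
  simp only [Pi.smul_apply, smul_eq_mul, mul_pow, Finset.prod_mul_distrib,
    Finset.prod_pow_eq_pow_sum, hdeg]
  ring

theorem aeval_eq_eval_self (v : ι → L) (f : MvPolynomial ι L) : aeval v f = eval v f := by
  rw [aeval_def, Algebra.algebraMap_self]
  rfl

theorem coords_ne_zero (p : ProjSpace L ι) : p.coords ≠ 0 :=
  Projectivization.rep_nonzero p

theorem mk_coords (p : ProjSpace L ι) : mk p.coords p.coords_ne_zero = p :=
  Projectivization.mk_rep p

theorem mk_smul {a : L} {v : ι → L} (hv : v ≠ 0) (hav : a • v ≠ 0) :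
    mk (a • v) hav = mk v hv :=
  (Projectivization.mk_eq_mk_iff' L _ _ hav hv).mpr ⟨a, rfl⟩

/-- The homogeneous vanishing ideal of a subset of projective space. -/
noncomputable def idealOf (Y : Set (ProjSpace L ι)) : Ideal (MvPolynomial ι L) :=
  vanishingIdeal L {v | ∃ hv : v ≠ 0, mk v hv ∈ Y}

theorem mem_idealOf {Y : Set (ProjSpace L ι)} {f : MvPolynomial ι L} :
    f ∈ idealOf Y ↔ ∀ v (hv : v ≠ 0), mk v hv ∈ Y → eval v f = 0 := by
  simp only [idealOf, mem_vanishingIdeal_iff, Set.mem_ofPred_eq, forall_exists_index,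
    aeval_eq_eval_self]

theorem mem_idealOf_of_isHomogeneous {Y : Set (ProjSpace L ι)} {f : MvPolynomial ι L} {m : ℕ}
    (hf : f.IsHomogeneous m) : f ∈ idealOf Y ↔ ∀ p ∈ Y, eval p.coords f = 0 := by
  rw [mem_idealOf]
  constructor
  · intro h p hp
    exact h _ p.coords_ne_zero (by rwa [mk_coords])
  · intro h v hv hY
    exact (eval_coords_mk_eq_zero_iff hf v hv).mp (h _ hY)

theorem idealOf_anti {Y Y' : Set (ProjSpace L ι)} (h : Y ⊆ Y') : idealOf Y' ≤ idealOf Y :=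
  vanishingIdeal_anti_mono fun _ ⟨hv, hY⟩ => ⟨hv, h hY⟩

theorem exists_X_notMem_idealOf {Y : Set (ProjSpace L ι)} (hY : Y.Nonempty) :
    ∃ i, X i ∉ idealOf Y := by
  obtain ⟨p, hp⟩ := hY
  obtain ⟨i, hi⟩ := Function.ne_iff.mp p.coords_ne_zero
  refine ⟨i, fun h => hi ?_⟩
  rw [mem_idealOf_of_isHomogeneous (isHomogeneous_X L i)] at h
  simpa using h p hp

theorem isHomogeneous_iff {I : Ideal (MvPolynomial ι L)} :
    I.IsHomogeneous (homogeneousSubmodule ι L) ↔ ∀ f ∈ I, ∀ m, homogeneousComponent m f ∈ I := by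
  constructor
  · exact fun h f hf m => homogeneousComponent_mem_of_mem h hf m
  · intro h i f hf
    have h1 : ((DirectSum.decompose (homogeneousSubmodule ι L) f) i : MvPolynomial ι L)
        = homogeneousComponent i f := decomposition.decompose'_apply f i
    rw [h1]
    exact h f hf i

theorem le_iff_of_isHomogeneous {I : Ideal (MvPolynomial ι L)}
    (hI : I.IsHomogeneous (homogeneousSubmodule ι L)) {J : Ideal (MvPolynomial ι L)} :
    I ≤ J ↔ ∀ f ∈ I, (∃ m, f.IsHomogeneous m) → f ∈ J := by
  constructor
  · exact fun h f hf _ => h hf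
  · intro h f hf
    rw [← sum_homogeneousComponent f]
    exact J.sum_mem fun m _ => h _ (homogeneousComponent_mem_of_mem hI hf m)
      ⟨m, homogeneousComponent_isHomogeneous m f⟩

/-- For fixed v, f(a v) is a polynomial in a whose coefficients are the values at v of the
homogeneous components of f. It vanishes for all a ≠ 0, hence identically over an infinite field. -/
theorem idealOf_isHomogeneous [Infinite L] (Y : Set (ProjSpace L ι)) :
    (idealOf Y).IsHomogeneous (homogeneousSubmodule ι L) := by
  rw [isHomogeneous_iff]
  intro f hf m
  rw [mem_idealOf] at hf ⊢
  intro v hv hY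
  set r : Polynomial L := ∑ j ∈ Finset.range (f.totalDegree + 1),
    Polynomial.C (eval v (homogeneousComponent j f)) * Polynomial.X ^ j
  have h1 : ∀ a : L, a ≠ 0 → r.eval a = 0 := by
    intro a ha
    have hav : a • v ≠ 0 := smul_ne_zero ha hv
    have h2 := hf (a • v) hav (by rwa [mk_smul hv])
    rw [← sum_homogeneousComponent f, map_sum] at h2
    rw [← h2, Polynomial.eval_finsetSum]
    refine Finset.sum_congr rfl fun j _ => ?_
    rw [eval_smul_of_isHomogeneous (homogeneousComponent_isHomogeneous j f)]
    rw [Polynomial.eval_mul, Polynomial.eval_C, Polynomial.eval_pow, Polynomial.eval_X, mul_comm]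
  have h2 : r = 0 := by
    refine Polynomial.eq_zero_of_infinite_isRoot r (Set.Infinite.mono (s := {0}ᶜ) ?_ ?_)
    · exact fun a ha => h1 a ha
    · exact (Set.finite_singleton (0 : L)).infinite_compl
  by_cases hm : m < f.totalDegree + 1
  · have h3 := congrArg (Polynomial.coeff · m) h2
    simpa [r, Polynomial.finsetSum_coeff, Polynomial.coeff_C_mul, Polynomial.coeff_X_pow,
      Nat.lt_succ_iff.mp hm, hm] using h3
  · rw [homogeneousComponent_eq_zero _ _ (by omega), map_zero]

theorem isClosed_zeroSet {S : Set (MvPolynomial ι L)} (hS : ∀ f ∈ S, ∃ m : ℕ, f.IsHomogeneous m) :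
    IsClosed (zeroSet S) :=
  (isClosed_iff_isZariskiClosed _).mpr ⟨S, hS, rfl⟩

theorem idealOf_isPrime [Infinite L] {Y : Set (ProjSpace L ι)} (hY : IsIrreducible Y) :
    (idealOf Y).IsPrime := by
  refine (idealOf_isHomogeneous Y).isPrime_of_homogeneous_mem_or_mem ?_ ?_
  · intro h
    obtain ⟨i, hi⟩ := exists_X_notMem_idealOf hY.nonempty
    rw [h] at hi
    exact hi Submodule.mem_top
  · rintro f g ⟨a, hf⟩ ⟨b, hg⟩ hfg
    have hf' : f.IsHomogeneous a := hf
    have hg' : g.IsHomogeneous b := hg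
    rw [mem_idealOf_of_isHomogeneous (hf'.mul hg')] at hfg
    rw [mem_idealOf_of_isHomogeneous hf', mem_idealOf_of_isHomogeneous hg']
    have h1 := isPreirreducible_iff_isClosed_union_isClosed.mp hY.isPreirreducible
      (zeroSet {f}) (zeroSet {g}) (isClosed_zeroSet (by rintro _ rfl; exact ⟨a, hf'⟩))
      (isClosed_zeroSet (by rintro _ rfl; exact ⟨b, hg'⟩)) (by
        intro p hp
        have := hfg p hp
        rw [map_mul, mul_eq_zero] at this
        simpa [zeroSet] using this)
    simpa [zeroSet, Set.subset_def] using h1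

/-- The subset of projective space cut out by an ideal. -/
def zeros (P : Ideal (MvPolynomial ι L)) : Set (ProjSpace L ι) :=
  zeroSet {f | f ∈ P ∧ ∃ m : ℕ, f.IsHomogeneous m}

theorem isClosed_zeros (P : Ideal (MvPolynomial ι L)) : IsClosed (zeros P) :=
  isClosed_zeroSet fun _ hf => hf.2

theorem zeros_anti {P Q : Ideal (MvPolynomial ι L)} (h : P ≤ Q) : zeros Q ⊆ zeros P :=
  fun _ hp f hf => hp f ⟨h hf.1, hf.2⟩

theorem subset_zeros_iff {P : Ideal (MvPolynomial ι L)}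
    (hP : P.IsHomogeneous (homogeneousSubmodule ι L)) {Y : Set (ProjSpace L ι)} :
    Y ⊆ zeros P ↔ P ≤ idealOf Y := by
  rw [le_iff_of_isHomogeneous hP]
  constructor
  · rintro h f hf ⟨m, hm⟩
    rw [mem_idealOf_of_isHomogeneous hm]
    exact fun p hp => h hp f ⟨hf, m, hm⟩
  · rintro h p hp f ⟨hf, m, hm⟩
    exact (mem_idealOf_of_isHomogeneous hm).mp (h f hf ⟨m, hm⟩) p hp

theorem mk_mem_zeros_iff {P : Ideal (MvPolynomial ι L)}
    (hP : P.IsHomogeneous (homogeneousSubmodule ι L)) (v : ι → L) (hv : v ≠ 0) :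
    mk v hv ∈ zeros P ↔ ∀ f ∈ P, eval v f = 0 := by
  have h1 : (∀ f ∈ P, eval v f = 0) ↔ P ≤ RingHom.ker (eval v) := Iff.rfl
  rw [h1, le_iff_of_isHomogeneous hP]
  constructor
  · rintro h f hf ⟨m, hm⟩
    exact (eval_coords_mk_eq_zero_iff hm v hv).mp (h f ⟨hf, m, hm⟩)
  · rintro h f ⟨hf, m, hm⟩
    exact (eval_coords_mk_eq_zero_iff hm v hv).mpr (h f hf ⟨m, hm⟩)

theorem zeros_idealOf {Y : Set (ProjSpace L ι)} (hY : IsClosed Y) : zeros (idealOf Y) = Y := by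
  obtain ⟨S, hS, rfl⟩ := (isClosed_iff_isZariskiClosed Y).mp hY
  apply Set.Subset.antisymm
  · intro p hp f hf
    obtain ⟨m, hm⟩ := hS f hf
    exact hp f ⟨(mem_idealOf_of_isHomogeneous hm).mpr fun q hq => hq f hf, m, hm⟩
  · rintro p hp f ⟨hf, m, hm⟩
    exact (mem_idealOf_of_isHomogeneous hm).mp hf p hp

theorem idealOf_closure (Y : Set (ProjSpace L ι)) [Infinite L] :
    idealOf (closure Y) = idealOf Y := by
  refine le_antisymm (idealOf_anti subset_closure) ?_
  rw [← subset_zeros_iff (idealOf_isHomogeneous Y)]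
  refine closure_minimal ?_ (isClosed_zeros _)
  rw [subset_zeros_iff (idealOf_isHomogeneous Y)]

/-- Projective Nullstellensatz. Multiplying f by X_i makes it vanish at the origin as well, so the
affine Nullstellensatz puts X_i f in P; the hypothesis on X_i excludes the irrelevant ideal. -/
theorem idealOf_zeros [IsAlgClosed L] [Finite ι] {P : Ideal (MvPolynomial ι L)} [P.IsPrime]
    (hP : P.IsHomogeneous (homogeneousSubmodule ι L)) {i : ι} (hi : X i ∉ P) :
    idealOf (zeros P) = P := by
  have : Infinite L := IsAlgClosed.instInfinite
  refine le_antisymm ?_ ((subset_zeros_iff hP).mp subset_rfl)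
  intro f hf
  have h1 : X i * f ∈ vanishingIdeal L (zeroLocus L P) := by
    intro v hv
    rw [aeval_eq_eval_self, map_mul, eval_X]
    by_cases h0 : v = 0
    · simp [h0]
    · rw [mem_idealOf.mp hf v h0 ((mk_mem_zeros_iff hP v h0).mpr fun g hg => hv g hg), mul_zero]
  rw [vanishingIdeal_zeroLocus_eq_radical, Ideal.IsPrime.radical ‹_›] at h1
  exact (Ideal.IsPrime.mem_or_mem ‹_› h1).resolve_left hi

theorem isIrreducible_zeros [IsAlgClosed L] [Finite ι] {P : Ideal (MvPolynomial ι L)}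
    [hp : P.IsPrime]
    (hP : P.IsHomogeneous (homogeneousSubmodule ι L)) {i : ι} (hi : X i ∉ P) :
    IsIrreducible (zeros P) := by
  have hid := idealOf_zeros hP hi
  constructor
  · by_contra hne
    rw [Set.not_nonempty_iff_eq_empty] at hne
    rw [hne] at hid
    apply hi
    rw [← hid, mem_idealOf]
    simp
  · rw [isPreirreducible_iff_isClosed_union_isClosed]
    intro Z₁ Z₂ h₁ h₂ hsub
    by_contra! hcon
    obtain ⟨S, hS, rfl⟩ := (isClosed_iff_isZariskiClosed _).mp h₁
    obtain ⟨T, hT, rfl⟩ := (isClosed_iff_isZariskiClosed _).mp h₂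
    simp only [Set.not_subset, zeroSet, Set.mem_ofPred_eq, not_forall] at hcon
    obtain ⟨⟨p, hp1, f, hf, hpf⟩, q, hq1, g, hg, hqg⟩ := hcon
    obtain ⟨a, ha⟩ := hS f hf
    obtain ⟨b, hb⟩ := hT g hg
    have hmul : f * g ∈ P := by
      rw [← hid, mem_idealOf_of_isHomogeneous (ha.mul hb)]
      intro r hr
      rw [map_mul]
      rcases hsub hr with h | h
      · rw [h f hf, zero_mul]
      · rw [h g hg, mul_zero]
    rcases hp.mem_or_mem hmul with h | h
    · rw [← hid, mem_idealOf_of_isHomogeneous ha] at h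
      exact hpf (h p hp1)
    · rw [← hid, mem_idealOf_of_isHomogeneous hb] at h
      exact hqg (h q hq1)

/-- The homogeneous core of Q is again prime and contains I, so minimality makes it equal to Q. -/
theorem isHomogeneous_of_mem_minimalPrimes {I Q : Ideal (MvPolynomial ι L)}
    (hI : I.IsHomogeneous (homogeneousSubmodule ι L)) (hQ : Q ∈ I.minimalPrimes) :
    Q.IsHomogeneous (homogeneousSubmodule ι L) := by
  have hle : I ≤ (Q.homogeneousCore (homogeneousSubmodule ι L)).toIdeal := by
    rw [← hI.toIdeal_homogeneousCore_eq_self]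
    exact Ideal.homogeneousCore_mono _ hQ.1.2
  have h1 := hQ.2 ⟨hQ.1.1.homogeneousCore, hle⟩ (Ideal.toIdeal_homogeneousCore_le _ Q)
  rw [Ideal.IsHomogeneous.iff_eq]
  exact le_antisymm (Ideal.toIdeal_homogeneousCore_le _ Q) h1

theorem isHomogeneous_span {S : Set (MvPolynomial ι L)}
    (hS : ∀ f ∈ S, ∃ m : ℕ, f.IsHomogeneous m) :
    (Ideal.span S).IsHomogeneous (homogeneousSubmodule ι L) :=
  Ideal.homogeneous_span _ S fun f hf => hS f hf

end ProjSpace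

/-! ### Dimension of closed subsets of projective space -/

namespace ProjSpace

open MvPolynomial TopologicalSpace

attribute [local instance] MvPolynomial.gradedAlgebra

universe u

variable {L : Type u} [Field L] [IsAlgClosed L] {ι : Type} [Finite ι]

/-- A chain of length r arises by cutting repeatedly with coordinate hyperplanes, each lowering the
dimension of the affine cone by exactly one. The cone has one dimension more than the projective
set, hence r + 1. -/
theorem le_height_zeros {r : ℕ} {P : Ideal (MvPolynomial ι L)} [P.IsPrime]
    (hP : P.IsHomogeneous (homogeneousSubmodule ι L)) (hr : quotDim P = r + 1)
    (Y : IrreducibleCloseds (ProjSpace L ι)) (hY : (Y : Set (ProjSpace L ι)) = zeros P) :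
    (r : ℕ∞) ≤ Order.height Y := by
  induction r generalizing P Y with
  | zero => simp
  | succ r ih =>
    have hex : ∀ (P : Ideal (MvPolynomial ι L)) [P.IsPrime] (r : ℕ), quotDim P = r + 1 →
        ∃ i, X i ∉ P := by
      intro P _ r hr
      by_contra! hcon
      have := quotDim_eq_zero_of_forall_mem (P := P) (v := 0) (by simpa using hcon)
      omega
    obtain ⟨i, hi⟩ := hex P _ hr
    have hI : (P ⊔ Ideal.span {X i}).IsHomogeneous (homogeneousSubmodule ι L) :=
      hP.sup (isHomogeneous_span (by rintro _ rfl; exact ⟨1, isHomogeneous_X L i⟩))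
    -- The origin lies on every such cone, so the cut ideal is proper and has a minimal prime.
    have hle : P ⊔ Ideal.span {X i} ≤ RingHom.ker (eval (0 : ι → L)) := by
      refine sup_le ?_ ?_
      · rw [le_iff_of_isHomogeneous hP]
        rintro f hf ⟨m, hm⟩
        rw [RingHom.mem_ker]
        by_cases h1 : m = 0
        · subst h1
          have h2 : f = C (coeff 0 f) :=
            totalDegree_eq_zero_iff_eq_C.mp (Nat.le_zero.mp hm.totalDegree_le)
          by_contra h3
          rw [h2, eval_C] at h3
          refine Ideal.IsPrime.ne_top ‹_› (P.eq_top_of_isUnit_mem hf ?_)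
          rw [h2]
          exact (IsUnit.mk0 _ h3).map C
        · have := eval_smul_of_isHomogeneous hm 0 0
          simpa [h1] using this
      · rw [Ideal.span_singleton_le_iff_mem, RingHom.mem_ker]
        simp
    have : (RingHom.ker (eval (0 : ι → L))).IsPrime := RingHom.ker_isPrime _
    obtain ⟨Q, hQ, -⟩ := Ideal.exists_minimalPrimes_le hle
    have hQp : Q.IsPrime := hQ.1.1
    have hQh := isHomogeneous_of_mem_minimalPrimes hI hQ
    have hdim := quotDim_add_one hi hQ
    obtain ⟨j, hj⟩ := hex Q r (by omega)
    set W : IrreducibleCloseds (ProjSpace L ι) :=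
      ⟨zeros Q, isIrreducible_zeros hQh hj, isClosed_zeros Q⟩
    have hlt : W < Y := by
      have h1 : (W : Set (ProjSpace L ι)) ⊆ Y := by
        rw [hY]
        exact zeros_anti (le_sup_left.trans hQ.1.2)
      refine lt_of_le_of_ne h1 ?_
      intro heq
      have h2 : zeros Q = zeros P := by rw [← hY, ← heq]; rfl
      have h3 : Q = P := by rw [← idealOf_zeros hQh hj, h2, idealOf_zeros hP hi]
      rw [h3] at hdim
      omega
    have h4 := ih hQh (by omega) W rfl
    calc ((r + 1 : ℕ) : ℕ∞) = (r : ℕ∞) + 1 := by push_cast; rfl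
      _ ≤ Order.height W + 1 := by gcongr
      _ ≤ Order.height Y := Order.height_add_one_le hlt

/-- Vanishing ideals embed the irreducible closed sets, order reversed, into the spectrum of a
polynomial ring of finite Krull dimension. This makes the dimension of Z a natural number. -/
theorem topologicalKrullDim_ne_top : topologicalKrullDim (ProjSpace L ι) ≠ ⊤ := by
  have : Infinite L := IsAlgClosed.instInfinite
  set φ : IrreducibleCloseds (ProjSpace L ι) → (PrimeSpectrum (MvPolynomial ι L))ᵒᵈ := fun Y =>
    OrderDual.toDual ⟨idealOf Y, idealOf_isPrime Y.isIrreducible⟩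
  have hφ : StrictMono φ := by
    intro Y Y' h
    have h1 : (Y : Set (ProjSpace L ι)) ⊆ Y' := h.le
    refine lt_of_le_of_ne ?_ ?_
    · exact idealOf_anti h1
    · intro heq
      have h2 : idealOf (Y : Set (ProjSpace L ι)) = idealOf Y' :=
        congrArg PrimeSpectrum.asIdeal heq
      have h3 : (Y : Set (ProjSpace L ι)) = Y' := by
        rw [← zeros_idealOf Y.isClosed, h2, zeros_idealOf Y'.isClosed]
      exact h.ne (IrreducibleCloseds.ext h3)
  have h1 : topologicalKrullDim (ProjSpace L ι) ≤ ringKrullDim (MvPolynomial ι L) := by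
    refine (Order.krullDim_le_of_strictMono φ hφ).trans ?_
    rw [Order.krullDim_orderDual]
    rfl
  rw [MvPolynomial.ringKrullDim_of_isNoetherianRing, ringKrullDim_eq_zero_of_field, zero_add] at h1
  intro h2
  rw [h2] at h1
  have : ((Nat.card ι : ℕ∞) : WithBot ℕ∞) < ⊤ := WithBot.coe_lt_coe.mpr (ENat.natCast_lt_top _)
  exact absurd h1 (not_le.mpr this)

theorem height_le_topologicalKrullDim {X : Type*} [TopologicalSpace X] {E : Set X}
    (Y : IrreducibleCloseds X) (hYE : (Y : Set X) ⊆ E) :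
    (Order.height Y : WithBot ℕ∞) ≤ topologicalKrullDim E := by
  rw [Order.height_eq_krullDim_Iic]
  set φ : Set.Iic Y → IrreducibleCloseds E := fun W =>
    { carrier := Subtype.val ⁻¹' (W.1 : Set X)
      isIrreducible' := by
        have hWE : (W.1 : Set X) ⊆ E := (show (W.1 : Set X) ⊆ Y from W.2).trans hYE
        refine ⟨?_, ?_⟩
        · obtain ⟨x, hx⟩ := W.1.isIrreducible.nonempty
          exact ⟨⟨x, hWE hx⟩, hx⟩
        · rintro _ _ ⟨u, hu, rfl⟩ ⟨v, hv, rfl⟩ ⟨x, hx, hxu⟩ ⟨y, hy, hyv⟩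
          obtain ⟨z, hz, hzuv⟩ := W.1.isIrreducible.isPreirreducible u v hu hv ⟨x, hx, hxu⟩
            ⟨y, hy, hyv⟩
          exact ⟨⟨z, hWE hz⟩, hz, hzuv⟩
      isClosed' := W.1.isClosed.preimage continuous_subtype_val }
  refine Order.krullDim_le_of_strictMono φ ?_
  intro W W' h
  have h1 : (W.1 : Set X) ⊆ W'.1 := h.le
  refine lt_of_le_of_ne (fun x hx => h1 hx) ?_
  intro heq
  apply h.ne
  refine Subtype.ext (IrreducibleCloseds.ext (Set.Subset.antisymm h1 ?_))
  intro x hx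
  have hxE : x ∈ E := hYE ((show (W'.1 : Set X) ⊆ Y from W'.2) hx)
  have h2 : (⟨x, hxE⟩ : E) ∈ (φ W : Set E) := by
    rw [heq]
    exact hx
  exact h2

end ProjSpace

/-! ### Irreducible components and minimal primes -/

section Components

open MvPolynomial ProjSpace

attribute [local instance] MvPolynomial.gradedAlgebra

variable {L : Type*} [Field L] [IsAlgClosed L] {ι : Type*} [Finite ι]

/-- The closure of an irreducible component of an open subset of a projective algebraic set
corresponds to a minimal prime of the equations. -/
theorem idealOf_mem_minimalPrimes {U : Set (ProjSpace L ι)} (hU : IsOpen U)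
    {I : Ideal (MvPolynomial ι L)} (hI : I.IsHomogeneous (homogeneousSubmodule ι L))
    {T : Set ↥(U ∩ zeros I)} (hT : T ∈ irreducibleComponents ↥(U ∩ zeros I)) :
    idealOf (Subtype.val '' T) ∈ I.minimalPrimes := by
  have : Infinite L := IsAlgClosed.instInfinite
  have hirr : IsIrreducible (Subtype.val '' T) :=
    IsIrreducible.image hT.1 _ continuous_subtype_val.continuousOn
  have hp := idealOf_isPrime hirr
  have hsub : Subtype.val '' T ⊆ zeros I := by
    rintro _ ⟨x, -, rfl⟩
    exact x.2.2
  have hIP : I ≤ idealOf (Subtype.val '' T) := (subset_zeros_iff hI).mp hsub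
  refine ⟨⟨hp, hIP⟩, ?_⟩
  rintro Q' ⟨hQ'p, hIQ'⟩ hle
  obtain ⟨Q, hQ, hQQ'⟩ := Ideal.exists_minimalPrimes_le hIQ'
  refine le_trans ?_ hQQ'
  have hQp : Q.IsPrime := hQ.1.1
  have hQh := isHomogeneous_of_mem_minimalPrimes hI hQ
  obtain ⟨i, hi⟩ := exists_X_notMem_idealOf hirr.nonempty
  have hiQ : X i ∉ Q := fun h => hi (hle (hQQ' h))
  have hQirr := isIrreducible_zeros hQh hiQ
  have hTQ : Subtype.val '' T ⊆ zeros Q := (subset_zeros_iff hQh).mpr (hQQ'.trans hle)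
  -- The trace of zeros Q on the open set U is irreducible and contains T, so it equals T by
  -- maximality. It is also dense in zeros Q, which forces Q to be the ideal of T.
  have hS : IsIrreducible (Subtype.val ⁻¹' zeros Q : Set ↥(U ∩ zeros I)) := by
    refine ⟨?_, ?_⟩
    · obtain ⟨x, hx⟩ := hT.1.nonempty
      exact ⟨x, hTQ ⟨x, hx, rfl⟩⟩
    · rintro _ _ ⟨u, hu, rfl⟩ ⟨v, hv, rfl⟩ ⟨x, hx, hxu⟩ ⟨y, hy, hyv⟩
      obtain ⟨z, hz, ⟨hzu, hzU⟩, hzv, -⟩ := hQirr.isPreirreducible (u ∩ U) (v ∩ U) (hu.inter hU)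
        (hv.inter hU) ⟨x, hx, hxu, x.2.1⟩ ⟨y, hy, hyv, y.2.1⟩
      exact ⟨⟨z, hzU, zeros_anti hQ.1.2 hz⟩, hz, hzu, hzv⟩
  have hST : Subtype.val ⁻¹' zeros Q ⊆ T := hT.2 hS fun x hx => hTQ ⟨x, hx, rfl⟩
  have hne : (zeros Q ∩ U).Nonempty := by
    obtain ⟨x, hx⟩ := hT.1.nonempty
    exact ⟨x, hTQ ⟨x, hx, rfl⟩, x.2.1⟩
  have hcl : zeros Q ⊆ closure (Subtype.val '' T) := by
    refine (subset_closure_inter_of_isPreirreducible_of_isOpen hQirr.isPreirreducible hU hne).trans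
      (closure_mono ?_)
    rintro z ⟨hz, hzU⟩
    exact ⟨⟨z, hzU, zeros_anti hQ.1.2 hz⟩, hST hz, rfl⟩
  rw [← idealOf_closure, ← idealOf_zeros hQh hiQ]
  exact idealOf_anti hcl

end Components

/-! ### The equations satisfied by the coefficients of x(t) -/

section Equations

open MvPolynomial ProjSpace

variable {R : Type*} [CommRing R] {ι : Type*}

/-- All coefficients of a polynomial in one variable over a polynomial ring are homogeneous of
degree `m`. -/
def HasHomogeneousCoeffs (m : ℕ) (p : Polynomial (MvPolynomial ι R)) : Prop :=
  ∀ k, (p.coeff k).IsHomogeneous m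

theorem HasHomogeneousCoeffs.mul {m m' : ℕ} {p p' : Polynomial (MvPolynomial ι R)}
    (h : HasHomogeneousCoeffs m p) (h' : HasHomogeneousCoeffs m' p') :
    HasHomogeneousCoeffs (m + m') (p * p') := by
  intro k
  rw [Polynomial.coeff_mul]
  exact IsHomogeneous.sum _ _ _ fun x _ => (h _).mul (h' _)

theorem HasHomogeneousCoeffs.sum {κ : Type*} {m : ℕ} (s : Finset κ)
    (p : κ → Polynomial (MvPolynomial ι R)) (h : ∀ i ∈ s, HasHomogeneousCoeffs m (p i)) :
    HasHomogeneousCoeffs m (∑ i ∈ s, p i) := by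
  intro k
  rw [Polynomial.finsetSum_coeff]
  exact IsHomogeneous.sum _ _ _ fun i hi => h i hi k

theorem hasHomogeneousCoeffs_map_C (p : Polynomial R) :
    HasHomogeneousCoeffs 0 (p.map (C : R →+* MvPolynomial ι R)) := by
  intro k
  rw [Polynomial.coeff_map]
  exact isHomogeneous_C _ _

theorem HasHomogeneousCoeffs.pow {m : ℕ} {p : Polynomial (MvPolynomial ι R)}
    (h : HasHomogeneousCoeffs m p) (j : ℕ) : HasHomogeneousCoeffs (j * m) (p ^ j) := by
  induction j with
  | zero => simpa using hasHomogeneousCoeffs_map_C (1 : Polynomial R)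
  | succ j ih =>
    rw [pow_succ, Nat.succ_mul]
    exact ih.mul h

theorem HasHomogeneousCoeffs.prod {κ : Type*} (s : Finset κ) (m : κ → ℕ)
    (p : κ → Polynomial (MvPolynomial ι R)) (h : ∀ i ∈ s, HasHomogeneousCoeffs (m i) (p i)) :
    HasHomogeneousCoeffs (∑ i ∈ s, m i) (∏ i ∈ s, p i) := by
  classical
  induction s using Finset.induction_on with
  | empty => simpa using hasHomogeneousCoeffs_map_C (1 : Polynomial R)
  | insert a s ha ih =>
    rw [Finset.sum_insert ha, Finset.prod_insert ha]
    exact (h a (Finset.mem_insert_self _ _)).mul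
      (ih fun i hi => h i (Finset.mem_insert_of_mem hi))

variable {n e : ℕ}

/-- The tuple of polynomials of degree at most `e` with indeterminate coefficients. -/
noncomputable def genericTuple (R : Type*) [CommRing R] (n e : ℕ) :
    Fin n → Polynomial (MvPolynomial (Fin n × Fin (e + 1)) R) :=
  fun i => ∑ j : Fin (e + 1), Polynomial.monomial (j : ℕ) (X (i, j))

theorem hasHomogeneousCoeffs_genericTuple (i : Fin n) :
    HasHomogeneousCoeffs 1 (genericTuple R n e i) := by
  refine HasHomogeneousCoeffs.sum _ _ fun j _ k => ?_
  rw [Polynomial.coeff_monomial]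
  split_ifs
  · exact isHomogeneous_X _ _
  · exact isHomogeneous_zero _ _ _

theorem natDegree_genericTuple_le (i : Fin n) : (genericTuple R n e i).natDegree ≤ e :=
  Polynomial.natDegree_sum_le_of_forall_le _ _ fun j _ =>
    (Polynomial.natDegree_monomial_le _).trans (by omega)

variable {L : Type*} [Field L]

theorem natDegree_polyTuple_le (v : Fin n × Fin (e + 1) → L) (i : Fin n) :
    (polyTuple v i).natDegree ≤ e :=
  Polynomial.natDegree_sum_le_of_forall_le _ _ fun j _ =>
    (Polynomial.natDegree_monomial_le _).trans (by omega)

theorem map_eval_genericTuple (v : Fin n × Fin (e + 1) → L) (i : Fin n) :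
    (genericTuple L n e i).map (eval v) = polyTuple v i := by
  simp [genericTuple, polyTuple, Polynomial.map_sum]

variable {K : Type*} [Field K] [Algebra K L]

/-- The value of a form at the generic tuple. -/
noncomputable def genericValue (L : Type*) [Field L] [Algebra K L] (e : ℕ)
    (F : MvPolynomial (Fin n) K) : Polynomial (MvPolynomial (Fin n × Fin (e + 1)) L) :=
  aeval (genericTuple L n e) F

theorem map_eval_genericValue (v : Fin n × Fin (e + 1) → L) (F : MvPolynomial (Fin n) K) :
    (genericValue L e F).map (eval v) = aeval (polyTuple v) F := by
  have h1 := MvPolynomial.map_aeval (genericTuple L n e) (Polynomial.mapRingHom (eval v)) F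
  rw [Polynomial.coe_mapRingHom] at h1
  rw [genericValue, h1, aeval_def, coe_eval₂Hom]
  congr 1
  · ext a
    simp [Polynomial.algebraMap_apply, MvPolynomial.algebraMap_apply]
  · funext i
    exact map_eval_genericTuple v i

theorem genericValue_eq_sum (F : MvPolynomial (Fin n) K) :
    genericValue L e F = ∑ s ∈ F.support,
      (Polynomial.C (algebraMap K L (F.coeff s))).map C
        * ∏ i ∈ s.support, genericTuple L n e i ^ s i := by
  rw [genericValue, aeval_def, eval₂_eq]
  refine Finset.sum_congr rfl fun s _ => ?_
  rw [Polynomial.map_C]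
  rfl

theorem hasHomogeneousCoeffs_genericValue {F : MvPolynomial (Fin n) K} {m : ℕ}
    (hF : F.IsHomogeneous m) : HasHomogeneousCoeffs m (genericValue L e F) := by
  rw [genericValue_eq_sum]
  refine HasHomogeneousCoeffs.sum _ _ fun s hs => ?_
  have hdeg : ∑ i ∈ s.support, s i * 1 = m := by
    have := hF (mem_support_iff.mp hs)
    rwa [Finsupp.weight_apply, Finsupp.sum] at this
  rw [← zero_add m, ← hdeg]
  exact (hasHomogeneousCoeffs_map_C _).mul
    (HasHomogeneousCoeffs.prod _ _ _ fun i _ => (hasHomogeneousCoeffs_genericTuple i).pow _)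

theorem natDegree_genericValue_le {F : MvPolynomial (Fin n) K} {m : ℕ}
    (hF : F.IsHomogeneous m) : (genericValue L e F).natDegree ≤ m * e := by
  rw [genericValue_eq_sum]
  refine Polynomial.natDegree_sum_le_of_forall_le _ _ fun s hs => ?_
  have hdeg : ∑ i ∈ s.support, s i = m := by
    have := hF (mem_support_iff.mp hs)
    rwa [Finsupp.weight_apply, Finsupp.sum, Finset.sum_congr rfl
      (fun i _ => by simp : ∀ i ∈ s.support, s i • (1 : Fin n → ℕ) i = s i)] at this
  rw [Polynomial.map_C]
  refine (Polynomial.natDegree_C_mul_le _ _).trans ((Polynomial.natDegree_prod_le _ _).trans ?_)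
  rw [← hdeg, Finset.sum_mul]
  refine Finset.sum_le_sum fun i _ => Polynomial.natDegree_pow_le.trans ?_
  exact Nat.mul_le_mul_left _ (natDegree_genericTuple_le i)

end Equations

/-! ### Openness of the coprime locus -/

section Coprime

open MvPolynomial ProjSpace

/-- Start from any Bézout relation and reduce every coefficient other than that of x i₀ modulo x i₀,
which has exact degree e. The bound on g then forces the remaining coefficient to have degree at
most e. -/
theorem exists_sum_mul_eq_of_coprime {L : Type*} [Field L] {n e : ℕ} {x : Fin n → Polynomial L}
    (hx : ∀ i, (x i).natDegree ≤ e) {i₀ : Fin n} (hi₀ : (x i₀).degree = e)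
    (hcop : ∀ g : Polynomial L, (∀ i, g ∣ x i) → IsUnit g) {g : Polynomial L}
    (hg : g.natDegree ≤ 2 * e) :
    ∃ y : Fin n → Polynomial L, (∀ i, (y i).natDegree ≤ e) ∧ ∑ i, x i * y i = g := by
  classical
  have htop : Ideal.span (Set.range x) = ⊤ := by
    have hpr : (Ideal.span (Set.range x)).IsPrincipal := IsPrincipalIdealRing.principal _
    rw [← Ideal.span_singleton_generator (Ideal.span (Set.range x)),
      Ideal.span_singleton_eq_top]
    refine hcop _ fun i => ?_
    rw [← Submodule.IsPrincipal.mem_iff_generator_dvd]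
    exact Ideal.subset_span ⟨i, rfl⟩
  obtain ⟨c, hc⟩ := Ideal.mem_span_range_iff_exists_fun.mp
    (htop ▸ Submodule.mem_top : g ∈ Ideal.span (Set.range x))
  have hx0 : x i₀ ≠ 0 := by
    intro h0
    rw [h0, Polynomial.degree_zero] at hi₀
    exact WithBot.bot_ne_coe hi₀
  have hnat : (x i₀).natDegree = e := Polynomial.natDegree_eq_of_degree_eq_some hi₀
  set a : Polynomial L := c i₀ + ∑ i ∈ Finset.univ.erase i₀, c i / x i₀ * x i
  have hmod : ∀ i, (c i % x i₀).natDegree ≤ e := fun i =>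
    (Polynomial.natDegree_le_natDegree (Polynomial.degree_mod_lt _ hx0).le).trans hnat.le
  have hsum : x i₀ * a + ∑ i ∈ Finset.univ.erase i₀, x i * (c i % x i₀) = g := by
    rw [← hc, ← Finset.add_sum_erase _ _ (Finset.mem_univ i₀)]
    simp only [a, mul_add, add_assoc, Finset.mul_sum]
    rw [← Finset.sum_add_distrib, mul_comm (c i₀)]
    congr 1
    refine Finset.sum_congr rfl fun i _ => ?_
    have h1 := EuclideanDomain.div_add_mod (c i) (x i₀)
    calc _ = x i * (x i₀ * (c i / x i₀) + c i % x i₀) := by ring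
      _ = _ := by rw [h1]; ring
  have ha : a.natDegree ≤ e := by
    by_cases ha0 : a = 0
    · simp [ha0]
    have h1 : (x i₀ * a).natDegree ≤ 2 * e := by
      rw [← eq_sub_iff_add_eq] at hsum
      rw [hsum]
      refine (Polynomial.natDegree_sub_le _ _).trans (max_le hg ?_)
      refine Polynomial.natDegree_sum_le_of_forall_le _ _ fun i _ => ?_
      refine Polynomial.natDegree_mul_le.trans ?_
      have := hx i
      have := hmod i
      omega
    rw [Polynomial.natDegree_mul hx0 ha0, hnat] at h1
    omega
  refine ⟨fun i => if i = i₀ then a else c i % x i₀, fun i => ?_, ?_⟩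
  · dsimp only
    split_ifs
    · exact ha
    · exact hmod i
  · rw [← hsum, ← Finset.add_sum_erase _ _ (Finset.mem_univ i₀)]
    dsimp only
    rw [if_pos rfl]
    congr 1
    refine Finset.sum_congr rfl fun i hi => ?_
    rw [if_neg (Finset.ne_of_mem_erase hi)]

variable {L : Type*} [Field L] {n e : ℕ}

/-- The matrix whose columns are the coefficients of the polynomials `∑ xᵢ yⱼᵢ`. -/
noncomputable def combinationMatrix (x : Fin n → Polynomial L)
    (y : Fin (2 * e + 1) → Fin n → Polynomial L) :
    Matrix (Fin (2 * e + 1)) (Fin (2 * e + 1)) L :=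
  Matrix.of fun r j => (∑ i, x i * y j i).coeff r

/-- With y fixed, the matrix entries are linear forms in the coefficients of x. -/
theorem exists_isHomogeneous_eval_eq_det (y : Fin (2 * e + 1) → Fin n → Polynomial L) :
    ∃ D : MvPolynomial (Fin n × Fin (e + 1)) L, D.IsHomogeneous (2 * e + 1) ∧
      ∀ v, eval v D = (combinationMatrix (polyTuple v) y).det := by
  set M : Matrix (Fin (2 * e + 1)) (Fin (2 * e + 1)) (MvPolynomial (Fin n × Fin (e + 1)) L) :=
    Matrix.of fun r j => (∑ i, genericTuple L n e i * (y j i).map C).coeff r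
  have hM : ∀ r j, (M r j).IsHomogeneous 1 := by
    intro r j
    refine HasHomogeneousCoeffs.sum (m := 1) Finset.univ
      (fun i => genericTuple L n e i * (y j i).map C) (fun i _ => ?_) r
    exact (hasHomogeneousCoeffs_genericTuple i).mul (hasHomogeneousCoeffs_map_C (y j i))
  refine ⟨M.det, ?_, fun v => ?_⟩
  · rw [Matrix.det_apply]
    refine IsHomogeneous.sum _ _ _ fun σ _ => ?_
    have h1 : (∏ i, M (σ i) i).IsHomogeneous (2 * e + 1) := by
      have := IsHomogeneous.prod Finset.univ (fun i => M (σ i) i) (fun _ => 1)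
        (fun i _ => hM _ _)
      simpa using this
    rcases Int.units_eq_one_or (Equiv.Perm.sign σ) with h | h
    · rw [h, one_smul]
      exact h1
    · rw [h, Units.neg_smul, one_smul]
      exact h1.neg
  · rw [RingHom.map_det]
    congr 1
    ext r j
    simp only [RingHom.mapMatrix_apply, Matrix.map_apply, M, combinationMatrix, Matrix.of_apply]
    rw [← Polynomial.coeff_map, Polynomial.map_sum]
    congr 1
    refine Finset.sum_congr rfl fun i _ => ?_
    rw [Polynomial.map_mul, map_eval_genericTuple, Polynomial.map_map]
    congr 1
    have : (eval v).comp (C : L →+* MvPolynomial (Fin n × Fin (e + 1)) L) = RingHom.id L := by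
      ext a
      simp
    rw [this, Polynomial.map_id]

theorem det_combinationMatrix_eq_zero_of_degree_ne {x : Fin n → Polynomial L}
    {y : Fin (2 * e + 1) → Fin n → Polynomial L} (hx : ∀ i, (x i).natDegree ≤ e)
    (hy : ∀ j i, (y j i).natDegree ≤ e) (hdeg : ∀ i, (x i).degree ≠ e) :
    (combinationMatrix x y).det = 0 := by
  -- The last row holds the coefficients of t^(2e), which vanish when every x i has degree below e.
  refine Matrix.det_eq_zero_of_row_eq_zero (Fin.last (2 * e)) fun j => ?_
  rw [combinationMatrix, Matrix.of_apply, Polynomial.finsetSum_coeff]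
  refine Finset.sum_eq_zero fun i _ => ?_
  by_cases h0 : x i = 0
  · simp [h0]
  refine Polynomial.coeff_eq_zero_of_natDegree_lt (Polynomial.natDegree_mul_le.trans_lt ?_)
  have h1 : (x i).natDegree ≠ e := fun h => hdeg i (by rw [Polynomial.degree_eq_natDegree h0, h])
  have := hx i
  have := hy j i
  rw [Fin.val_last]
  omega

theorem det_combinationMatrix_eq_zero_of_common_root {x : Fin n → Polynomial L}
    {y : Fin (2 * e + 1) → Fin n → Polynomial L} (hx : ∀ i, (x i).natDegree ≤ e)
    (hy : ∀ j i, (y j i).natDegree ≤ e) {r : L} (hr : ∀ i, (x i).eval r = 0) :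
    (combinationMatrix x y).det = 0 := by
  rw [← Matrix.exists_vecMul_eq_zero_iff]
  -- Pairing a column with the powers of r evaluates the corresponding combination at the common
  -- root.
  refine ⟨fun k => r ^ (k : ℕ), ?_, ?_⟩
  · intro h
    have := congrFun h 0
    simp at this
  · funext j
    have hdeg : (∑ i, x i * y j i).natDegree < 2 * e + 1 := by
      refine Nat.lt_succ_of_le (Polynomial.natDegree_sum_le_of_forall_le _ _ fun i _ => ?_)
      refine Polynomial.natDegree_mul_le.trans ?_
      have := hx i
      have := hy j i
      omega
    have h1 : (∑ i, x i * y j i).eval r = 0 := by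
      rw [Polynomial.eval_finsetSum]
      exact Finset.sum_eq_zero fun i _ => by rw [Polynomial.eval_mul, hr, zero_mul]
    rw [Polynomial.eval_eq_sum_range' hdeg, ← Fin.sum_univ_eq_sum_range
      (fun k => (∑ i, x i * y j i).coeff k * r ^ k)] at h1
    rw [Pi.zero_apply, ← h1]
    simp only [Matrix.vecMul, dotProduct, combinationMatrix, Matrix.of_apply]
    exact Finset.sum_congr rfl fun k _ => mul_comm _ _

/-- Near p, choose y so that the combinations of x with y are 1, t, …, t^(2e). The determinant for
this fixed y is a form in the coefficients, equals 1 at p, and vanishes at every tuple that has a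
common factor or too small a degree. -/
theorem isOpen_coprimeLocus (K : Type*) [Field K] (n e : ℕ) : IsOpen (coprimeLocus K n e) := by
  rw [isOpen_iff_forall_mem_open]
  rintro p ⟨⟨i₀, hi₀⟩, hcop⟩
  have hy : ∀ j : Fin (2 * e + 1), ∃ y : Fin n → Polynomial (AlgebraicClosure K),
      (∀ i, (y i).natDegree ≤ e) ∧ ∑ i, polyTuple p.coords i * y i = Polynomial.X ^ (j : ℕ) :=
    fun j => exists_sum_mul_eq_of_coprime (natDegree_polyTuple_le _) hi₀ hcop
      (by rw [Polynomial.natDegree_X_pow]; omega)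
  choose y hydeg hysum using hy
  obtain ⟨D, hD, hDeval⟩ := exists_isHomogeneous_eval_eq_det y
  refine ⟨(zeroSet {D})ᶜ, ?_, ?_, ?_⟩
  · intro p' hp'
    have hne : (combinationMatrix (polyTuple p'.coords) y).det ≠ 0 := by
      rw [← hDeval]
      simpa [zeroSet] using hp'
    refine ⟨?_, ?_⟩
    · by_contra! hcon
      exact hne (det_combinationMatrix_eq_zero_of_degree_ne (natDegree_polyTuple_le _) hydeg hcon)
    · intro g hg
      by_contra hu
      obtain ⟨r, hr⟩ := IsAlgClosed.exists_root g
        (fun h => hu (Polynomial.isUnit_iff_degree_eq_zero.mpr h))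
      refine hne (det_combinationMatrix_eq_zero_of_common_root (natDegree_polyTuple_le _) hydeg
        (r := r) fun i => ?_)
      exact Polynomial.eval_eq_zero_of_dvd_of_eval_eq_zero (hg i) hr
  · exact (isClosed_zeroSet (by rintro _ rfl; exact ⟨_, hD⟩)).isOpen_compl
  · have h1 : combinationMatrix (polyTuple p.coords) y = 1 := by
      ext r j
      rw [combinationMatrix, Matrix.of_apply, hysum, Polynomial.coeff_X_pow, Matrix.one_apply]
      simp only [Fin.ext_iff]
    have h2 : eval p.coords D ≠ 0 := by
      rw [hDeval, h1, Matrix.det_one]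
      exact one_ne_zero
    simpa [zeroSet] using h2

end Coprime

/-! ### Degree of the equations and the final count -/

section Main

open MvPolynomial ProjSpace

attribute [local instance] MvPolynomial.gradedAlgebra

variable {K : Type*} [Field K] {n R : ℕ}

/-- The equations of the scheme of tuples of polynomials on which the given forms vanish. -/
noncomputable def equations (d : Fin R → ℕ) (F : Fin R → MvPolynomial (Fin n) K) (e : ℕ) :
    List (MvPolynomial (Fin n × Fin (e + 1)) (AlgebraicClosure K) × ℕ) :=
  (Finset.univ : Finset (Σ i, Fin (d i * e + 1))).toList.map fun x =>
    ((genericValue (AlgebraicClosure K) e (F x.1)).coeff x.2, d x.1)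

theorem mem_equations_iff {d : Fin R → ℕ} {F : Fin R → MvPolynomial (Fin n) K} {e : ℕ}
    {f : MvPolynomial (Fin n × Fin (e + 1)) (AlgebraicClosure K)} :
    f ∈ (equations d F e).map Prod.fst ↔ ∃ i, ∃ k : Fin (d i * e + 1),
      (genericValue (AlgebraicClosure K) e (F i)).coeff k = f := by
  simp [equations]

/-- F_i contributes d_i e + 1 equations of degree d_i, that is, a factor d_i · (d_i^d_i)^e. -/
theorem prod_equations (d : Fin R → ℕ) (F : Fin R → MvPolynomial (Fin n) K) (e : ℕ) :
    ((equations d F e).map Prod.snd).prod = (∏ i, d i) * (∏ i, d i ^ d i) ^ e := by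
  have h1 : ((equations d F e).map Prod.snd).prod
      = ∏ x : (Σ i, Fin (d i * e + 1)), d x.1 := by
    rw [equations, List.map_map]
    exact Finset.prod_map_toList _ _
  rw [h1, ← Finset.univ_sigma_univ, Finset.prod_sigma, ← Finset.prod_pow, ← Finset.prod_mul_distrib]
  refine Finset.prod_congr rfl fun i _ => ?_
  simp only [Finset.prod_const, Finset.card_univ, Fintype.card_fin]
  rw [pow_succ, pow_mul, mul_comm]

theorem isHomogeneous_ofList_equations {d : Fin R → ℕ} {F : Fin R → MvPolynomial (Fin n) K}
    (hF : ∀ i, (F i).IsHomogeneous (d i)) (e : ℕ) :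
    (Ideal.ofList ((equations d F e).map Prod.fst)).IsHomogeneous (homogeneousSubmodule _ _) := by
  refine isHomogeneous_span fun f hf => ?_
  obtain ⟨i, k, rfl⟩ := mem_equations_iff.mp hf
  exact ⟨d i, hasHomogeneousCoeffs_genericValue (hF i) k⟩

theorem equationLocus_eq_zeros {d : Fin R → ℕ} {F : Fin R → MvPolynomial (Fin n) K}
    (hF : ∀ i, (F i).IsHomogeneous (d i)) (e : ℕ) :
    equationLocus F e = zeros (Ideal.ofList ((equations d F e).map Prod.fst)) := by
  ext p
  have h1 : p ∈ zeros (Ideal.ofList ((equations d F e).map Prod.fst)) ↔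
      ∀ f ∈ (equations d F e).map Prod.fst, eval p.coords f = 0 := by
    have h2 := mk_mem_zeros_iff (isHomogeneous_ofList_equations hF e) p.coords p.coords_ne_zero
    rw [mk_coords] at h2
    rw [h2]
    exact Ideal.span_le (I := RingHom.ker (eval p.coords))
  rw [h1]
  constructor
  · intro hp f hf
    obtain ⟨i, k, rfl⟩ := mem_equations_iff.mp hf
    rw [← Polynomial.coeff_map, map_eval_genericValue, hp i, Polynomial.coeff_zero]
  · intro hp i
    rw [← map_eval_genericValue]
    ext k
    rw [Polynomial.coeff_map, Polynomial.coeff_zero]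
    by_cases hk : k < d i * e + 1
    · exact hp _ (mem_equations_iff.mpr ⟨i, ⟨k, hk⟩, rfl⟩)
    · rw [Polynomial.coeff_eq_zero_of_natDegree_lt, map_zero]
      have := natDegree_genericValue_le (L := AlgebraicClosure K) (e := e) (hF i)
      omega

/-- Each rational point has at least `#K - 1` representatives with coordinates in `K`. -/
theorem ncard_rationalPoints_mul_le {K L : Type*} [Field K] [Finite K] [Field L] [Algebra K L]
    {ι : Type*} [Finite ι] (Z : Set (ProjSpace L ι)) (A : Finset (ι → K))
    (hA : ∀ v : ι → K, ∀ hv : (fun i => algebraMap K L (v i)) ≠ 0, mk _ hv ∈ Z → v ∈ A) :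
    (rationalPoints K Z).Finite ∧ (rationalPoints K Z).ncard * (Nat.card K - 1) ≤ A.card := by
  classical
  have hrep : ∀ p : rationalPoints K Z, ∃ v : ι → K,
      ∃ hv : (fun i => algebraMap K L (v i)) ≠ 0, p.1 = mk _ hv := fun p => p.2.2
  choose v hv hp using hrep
  have hsmul : ∀ (p : rationalPoints K Z) (a : Kˣ),
      (fun i => algebraMap K L ((a.1 • v p) i)) 
        = algebraMap K L a.1 • fun i => algebraMap K L (v p i) := by
    intro p a
    funext i
    simp
  have hne : ∀ (p : rationalPoints K Z) (a : Kˣ),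
      (fun i => algebraMap K L ((a.1 • v p) i)) ≠ 0 := by
    intro p a
    rw [hsmul]
    exact smul_ne_zero (by simp) (hv p)
  have hmk : ∀ (p : rationalPoints K Z) (a : Kˣ), mk _ (hne p a) = p.1 := by
    intro p a
    rw [hp p]
    simp only [hsmul]
    exact mk_smul (hv p) _
  -- One representative is fixed for each point, and the q - 1 units of K scale it to distinct
  -- vectors.
  set Φ : rationalPoints K Z × Kˣ → A := fun x => ⟨x.2.1 • v x.1, hA _ (hne x.1 x.2) (by
    rw [hmk]
    exact x.1.2.1)⟩
  have hΦ : Function.Injective Φ := by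
    rintro ⟨p, a⟩ ⟨p', a'⟩ h
    have h1 : a.1 • v p = a'.1 • v p' := congrArg Subtype.val h
    have h2 : p = p' := by
      apply Subtype.ext
      rw [← hmk p a, ← hmk p' a']
      simp only [h1]
    subst h2
    obtain ⟨i, hi⟩ := Function.ne_iff.mp (hv p)
    have h3 : v p i ≠ 0 := fun h0 => hi (by simp [h0])
    have h4 := congrFun h1 i
    simp only [Pi.smul_apply, smul_eq_mul] at h4
    have h5 : a = a' := Units.ext (mul_right_cancel₀ h3 h4)
    rw [h5]
  have hfin : Finite (rationalPoints K Z) :=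
    Finite.of_injective (fun p => Φ (p, 1)) fun p p' h => congrArg Prod.fst (hΦ h)
  refine ⟨Set.toFinite _, ?_⟩
  have h1 := Nat.card_le_card_of_injective Φ hΦ
  rw [Nat.card_prod, Nat.card_units, Nat.card_eq_fintype_card (α := A), Fintype.card_coe] at h1
  exact h1

universe u

theorem exists_dim_eq_and_encard_rationalPoints_le {K : Type u} [Field K] [Finite K] {n R : ℕ}
    (e : ℕ) (d : Fin R → ℕ) (hd : ∀ i, 1 ≤ d i) (F : Fin R → MvPolynomial (Fin n) K)
    (hF : ∀ i, (F i).IsHomogeneous (d i))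
    (Z : Set (ProjSpace (AlgebraicClosure K) (Fin n × Fin (e + 1))))
    (hZ : IsUnionOfComponents (morSpace F e) Z) (hne : Z.Nonempty) :
    ∃ m : ℕ, dim Z = m ∧ (rationalPoints K Z).encard ≤
      ((2 * (∏ i, d i) * (∏ i, d i ^ d i) ^ e * Nat.card K ^ m : ℕ) : ℕ∞) := by
  classical
  have hinf : Infinite (AlgebraicClosure K) := IsAlgClosed.instInfinite
  set I := Ideal.ofList ((equations d F e).map Prod.fst)
  have hI : I.IsHomogeneous (homogeneousSubmodule _ _) := isHomogeneous_ofList_equations hF e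
  rw [morSpace, equationLocus_eq_zeros hF e] at hZ
  obtain ⟨T, hT, rfl⟩ := hZ
  set Z := Subtype.val '' ⋃₀ T
  have hirr : ∀ t ∈ T, IsIrreducible (Subtype.val '' t) := fun t ht =>
    IsIrreducible.image (hT ht).1 _ continuous_subtype_val.continuousOn
  have hsub : ∀ t ∈ T, closure (Subtype.val '' t) ⊆ closure Z := fun t ht =>
    closure_mono (Set.image_mono (Set.subset_sUnion_of_mem ht))
  have hmin : ∀ t ∈ T, idealOf (Subtype.val '' t) ∈ I.minimalPrimes := fun t ht =>
    idealOf_mem_minimalPrimes (isOpen_coprimeLocus K n e) hI (hT ht)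
  have hdimle : ∀ t (ht : t ∈ T), (Order.height (⟨closure (Subtype.val '' t), (hirr t ht).closure,
      isClosed_closure⟩ : TopologicalSpace.IrreducibleCloseds _) : WithBot ℕ∞) ≤ dim Z :=
    fun t ht => height_le_topologicalKrullDim _ (hsub t ht)
  obtain ⟨m, hm⟩ : ∃ m : ℕ, dim Z = m := by
    have htop : dim Z ≠ ⊤ := by
      intro h
      have hle : dim Z ≤ topologicalKrullDim
          (ProjSpace (AlgebraicClosure K) (Fin n × Fin (e + 1))) :=
        topologicalKrullDim_subspace_le _ _
      rw [h, top_le_iff] at hle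
      exact topologicalKrullDim_ne_top hle
    have hbot : dim Z ≠ ⊥ := by
      intro h
      obtain ⟨_, x, ⟨t, ht, -⟩, -⟩ := hne
      have := hdimle t ht
      rw [h, le_bot_iff] at this
      exact WithBot.coe_ne_bot this
    obtain ⟨N, hN⟩ := WithBot.ne_bot_iff_exists.mp hbot
    have hN' : N ≠ ⊤ := by
      rintro rfl
      exact htop hN.symm
    obtain ⟨m, rfl⟩ := ENat.ne_top_iff_exists.mp hN'
    exact ⟨m, hN.symm⟩
  refine ⟨m, hm, ?_⟩
  have hfin : I.minimalPrimes.Finite := Ideal.finite_minimalPrimes_of_isNoetherianRing _ _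
  set s := hfin.toFinset.filter fun P => ∃ t ∈ T, idealOf (Subtype.val '' t) = P
  have hs : ∀ P ∈ s, P ∈ I.minimalPrimes := fun P hP =>
    hfin.mem_toFinset.mp (Finset.mem_filter.mp hP).1
  -- The cone over a component exceeds the component's dimension by at most one, and the component's
  -- closure lies in that of Z. A cone of dimension zero satisfies the bound trivially.
  have hquot : ∀ P ∈ s, quotDim P ≤ m + 1 := by
    intro P hP
    obtain ⟨t, ht, rfl⟩ := (Finset.mem_filter.mp hP).2
    have hp := idealOf_isPrime (hirr t ht)
    rcases h : quotDim (idealOf (Subtype.val '' t)) with _ | r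
    · omega
    have h1 := le_height_zeros (idealOf_isHomogeneous _) h ⟨closure (Subtype.val '' t),
      (hirr t ht).closure, isClosed_closure⟩
      (by rw [← idealOf_closure, zeros_idealOf isClosed_closure]; rfl)
    have h2 := hdimle t ht
    rw [hm] at h2
    have h3 : ((r : ℕ∞) : WithBot ℕ∞) ≤ ((m : ℕ∞) : WithBot ℕ∞) :=
      (WithBot.coe_le_coe.mpr h1).trans h2
    have h4 : r ≤ m := by exact_mod_cast WithBot.coe_le_coe.mp h3
    omega
  -- The rational vectors of the affine cones over the closures of the chosen components; these
  -- include every rational representative of a point of Z.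
  set A : Finset (Fin n × Fin (e + 1) → K) :=
    s.biUnion fun P => (rationalZeros K P).toFinite.toFinset
  obtain ⟨hRfin, hRcard⟩ := ncard_rationalPoints_mul_le Z A (by
    rintro v hv ⟨x, ⟨t, ht, hxt⟩, hx⟩
    rw [Finset.mem_biUnion]
    refine ⟨idealOf (Subtype.val '' t), Finset.mem_filter.mpr
      ⟨hfin.mem_toFinset.mpr (hmin t ht), t, ht, rfl⟩, ?_⟩
    rw [Set.Finite.mem_toFinset]
    refine (mk_mem_zeros_iff (idealOf_isHomogeneous _) _ hv).mp ?_
    exact (subset_zeros_iff (idealOf_isHomogeneous _)).mpr le_rfl ⟨x, hxt, hx⟩)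
  set q := Nat.card K
  have hq : 2 ≤ q := Finite.one_lt_card
  have hq0 : (0 : ℝ) < q := by positivity
  set D := (∏ i, d i) * (∏ i, d i ^ d i) ^ e
  have hsum : ∑ P ∈ s, ((rationalZeros K P).ncard / (q : ℝ) ^ quotDim P) ≤ D := by
    have h1 := sum_le_prod_of_hilbertLowerBound (equations d F e) (by
      intro p hp
      obtain ⟨x, -, rfl⟩ := List.mem_map.mp hp
      exact ⟨(hasHomogeneousCoeffs_genericValue (hF x.1) x.2).totalDegree_le, hd x.1⟩) s hs
      (fun P => (rationalZeros K P).ncard / (q : ℝ) ^ quotDim P) (fun P _ => by positivity)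
      (fun P hP => by
        have := (hs P hP).1.1
        exact hilbertLowerBound_ncard_rationalZeros K P)
    rwa [prod_equations] at h1
  have hAcard : (A.card : ℝ) ≤ D * (q : ℝ) ^ (m + 1) := by
    have h1 : A.card ≤ ∑ P ∈ s, (rationalZeros K P).ncard := by
      refine Finset.card_biUnion_le.trans (Finset.sum_le_sum fun P _ => ?_)
      rw [Set.ncard_eq_toFinset_card _]
    have h2 : ∑ P ∈ s, ((rationalZeros K P).ncard : ℝ)
        ≤ (∑ P ∈ s, ((rationalZeros K P).ncard / (q : ℝ) ^ quotDim P)) * (q : ℝ) ^ (m + 1) := by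
      rw [Finset.sum_mul]
      refine Finset.sum_le_sum fun P hP => ?_
      rw [div_mul_eq_mul_div, le_div_iff₀ (by positivity)]
      refine mul_le_mul_of_nonneg_left ?_ (by positivity)
      exact pow_le_pow_right₀ (by exact_mod_cast (by omega : 1 ≤ q)) (hquot P hP)
    calc (A.card : ℝ) ≤ ∑ P ∈ s, ((rationalZeros K P).ncard : ℝ) := by exact_mod_cast h1
      _ ≤ _ := h2
      _ ≤ _ := mul_le_mul_of_nonneg_right hsum (by positivity)
  have hAcard' : A.card ≤ D * q ^ (m + 1) := by exact_mod_cast hAcard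
  rw [← hRfin.cast_ncard_eq, Nat.cast_le]
  have h1 : (rationalPoints K Z).ncard * q ≤ 2 * D * q ^ m * q := by
    -- Here q ≤ 2(q - 1), because q ≥ 2.
    calc (rationalPoints K Z).ncard * q ≤ (rationalPoints K Z).ncard * (2 * (q - 1)) :=
          Nat.mul_le_mul_left _ (by omega)
      _ = 2 * ((rationalPoints K Z).ncard * (q - 1)) := by ring
      _ ≤ 2 * (D * q ^ (m + 1)) := Nat.mul_le_mul_left _ (hRcard.trans hAcard')
      _ = _ := by ring
  have h2 := Nat.le_of_mul_le_mul_right h1 (by omega)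
  rwa [show 2 * D * q ^ m = 2 * (∏ i, d i) * (∏ i, d i ^ d i) ^ e * q ^ m by
    simp only [D]; ring] at h2

end Main

end RatCurves

theorem proposition3p1 {K : Type*} [Field K] [Finite K] (n R e : ℕ) (d : Fin R → ℕ)
    (hd : ∀ i, 1 ≤ d i) (F : Fin R → MvPolynomial (Fin n) K)
    (hF : ∀ i, (F i).IsHomogeneous (d i))
    (Z : Set (RatCurves.ProjSpace (AlgebraicClosure K) (Fin n × Fin (e + 1))))
    (hZ : RatCurves.ProjSpace.IsUnionOfComponents (RatCurves.morSpace F e) Z)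
    (hne : Z.Nonempty) :
    ∃ m : ℕ, RatCurves.ProjSpace.dim Z = m ∧
      (RatCurves.ProjSpace.rationalPoints K Z).encard ≤
        ((2 * (∏ i, d i) * (∏ i, d i ^ d i) ^ e * Nat.card K ^ m : ℕ) : ℕ∞) :=
  RatCurves.exists_dim_eq_and_encard_rationalPoints_le e d hd F hF Z hZ hne
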